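/- Let $n\ge 0$, let $A$ be a real $n\times n$ matrix that is Hurwitz (all its complex eigenvalues have negative real part), and let $N$ be a symmetric positive semidefinite real $n\times n$ matrix. Consider the linear system $dX(t)=A\,X(t)\,dt+dw(t)$, $t\ge 0$, where $w$ is an $n$-dimensional Brownian motion with covariance $N$ relative to a filtration, and $X$ is an adapted continuous solution with arbitrary initial state $X(0)$. For $t,h\ge 0$ let $\Delta X(t)$ denote the change of state $X(t+h)-X(t)$ conditioned on $X(t)$ (here $h$ is the sampling interval $\Delta t$), and let $$\mathcal W(h)=\int_0^{h} e^{A(h-\tau)}\,N\,e^{A^{T}(h-\tau)}\,d\tau .$$ For a probability measure $P$ on $\mathbb R^n$ (the source) and $D\ge 0$, the rate distortion function $R_P(D)\in[0,\infty]$, in nats, is the infimum of the mutual information $I(\hat X;X)$ over all conditional laws $Q(\hat x\,|\,x)$ on $\mathbb R^n$ such that $E\|X-\hat X\|_2^2\le D$, where $X\sim P$ and $\hat X\,|\,X=x\sim Q(\cdot\,|\,x)$. Then: (0) for all $t,h\ge 0$ and almost every $x$ with respect to the law of $X(t)$, the law of $X(t+h)-X(t)$ given $X(t)=x$ is the Gaussian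 law $N\big((e^{Ah}-I)x,\ \mathcal W(h)\big)$. Let $R_{h}(D)$ denote the rate distortion function of this Gaussian source. It does not depend on $x\in\mathbb R^n$, and hence neither on $t$; (1) the Lyapunov equation $A\mathcal W_\infty+\mathcal W_\infty A^{T}+N=0$ has exactly one solution $\mathcal W_\infty$ among all real $n\times n$ matrices. It is symmetric positive semidefinite, and positive definite if $N$ is; (2) $R_{h}(D)\le R_\infty(D)$ for all $D\ge 0$ and $h\ge 0$, where $R_\infty(D)$ is the rate distortion function of a Gaussian source with covariance $\mathcal W_\infty$ (and any mean); (3) for every $D\ge 0$, $R_{h}(D)$ is non-decreasing in $h\ge 0$, and $R_{h}(D)\to R_\infty(D)$ as $h\to\infty$ (in $[0,\infty]$). -/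

import Mathlib

open MeasureTheory ProbabilityTheory Filter Topology
open scoped NNReal ENNReal Matrix

namespace LinSys

/-- Mutual information (in nats) between a source with law `P` and its reproduction through the
random channel `Q`: the Kullback-Leibler divergence of the joint law from the product of its
two marginals. -/
noncomputable def mutualInfo {E F : Type*} [MeasurableSpace E] [MeasurableSpace F]
    (P : Measure E) (Q : Kernel E F) : ℝ≥0∞ :=
  InformationTheory.klDiv (P ⊗ₘ Q) (P.prod (Q ∘ₘ P))

/-- Mean square error between a source with law `P` and its reproduction through `Q`. -/
noncomputable def meanSquareError {E : Type*} [MeasurableSpace E] [NormedAddCommGroup E]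
    (P : Measure E) (Q : Kernel E E) : ℝ≥0∞ :=
  ∫⁻ z, ‖z.1 - z.2‖ₑ ^ 2 ∂(P ⊗ₘ Q)

/-- Rate distortion function (in nats per symbol) of a source with law `P`, for the mean square
error: the least mutual information among the conditional laws `Q` of the reproduction given the
source with mean square error at most `D`. -/
noncomputable def rateDistortion {E : Type*} [MeasurableSpace E] [NormedAddCommGroup E]
    (P : Measure E) (D : ℝ≥0) : ℝ≥0∞ :=
  ⨅ (Q : Kernel E E) (_ : IsMarkovKernel Q) (_ : meanSquareError P Q ≤ (D : ℝ≥0∞)),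
    mutualInfo P Q

variable {n : ℕ}

/-- `A` is Hurwitz: every complex eigenvalue of `A` has negative real part. -/
def IsHurwitz (A : Matrix (Fin n) (Fin n) ℝ) : Prop :=
  ∀ z ∈ spectrum ℂ (A.map (fun r : ℝ => (r : ℂ))), z.re < 0

/-- The noise Gramian `∫₀ʰ exp((h - τ)A) N exp((h - τ)Aᵀ) dτ`, entry by entry. -/
noncomputable def noiseGramian (A N : Matrix (Fin n) (Fin n) ℝ) (h : ℝ≥0) :
    Matrix (Fin n) (Fin n) ℝ :=
  Matrix.of fun i j => ∫ τ in (0 : ℝ)..h,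
    (NormedSpace.exp (((h : ℝ) - τ) • A) * N * NormedSpace.exp (((h : ℝ) - τ) • Aᵀ)) i j

/-- The mean `(exp(hA) - I) x` of the change of state over a time `h` from the state `x`. -/
noncomputable def meanIncrement (A : Matrix (Fin n) (Fin n) ℝ) (h : ℝ≥0)
    (x : EuclideanSpace ℝ (Fin n)) : EuclideanSpace ℝ (Fin n) :=
  Matrix.toEuclideanCLM (𝕜 := ℝ) (NormedSpace.exp ((h : ℝ) • A) - 1) x

/-- The Gaussian law `N((exp(hA) - I) x, W(h))`, where `W` is the noise Gramian. -/
noncomputable def incrementLaw (A N : Matrix (Fin n) (Fin n) ℝ) (h : ℝ≥0)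
    (x : EuclideanSpace ℝ (Fin n)) : Measure (EuclideanSpace ℝ (Fin n)) :=
  multivariateGaussian (meanIncrement A h x) (noiseGramian A N h)

/-- `w` is an `n`-dimensional Brownian motion with covariance `N`, relative to the
filtration `ℱ`. -/
structure IsBrownianMotion {Ω : Type*} {m : MeasurableSpace Ω} (N : Matrix (Fin n) (Fin n) ℝ)
    (ℱ : Filtration ℝ≥0 m) (P : Measure Ω) (w : ℝ≥0 → Ω → EuclideanSpace ℝ (Fin n)) : Prop where
  adapted : Adapted ℱ w
  zero : ∀ᵐ ω ∂P, w 0 ω = 0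
  continuous : ∀ᵐ ω ∂P, Continuous fun t => w t ω
  law_increment : ∀ s t, s ≤ t →
    P.map (fun ω => w t ω - w s ω) = multivariateGaussian 0 (((t : ℝ) - s) • N)
  indep_increment : ∀ s t, s ≤ t →
    Indep (MeasurableSpace.comap (fun ω => w t ω - w s ω) inferInstance) (ℱ s) P

/-- `X` solves `dX(t) = A X(t) dt + dw(t)`. The noise is additive, so the equation is the
integral equation `X(t) = X(0) + ∫₀ᵗ A X(s) ds + w(t)` along almost every path. -/
structure IsSolution {Ω : Type*} {m : MeasurableSpace Ω} (A : Matrix (Fin n) (Fin n) ℝ)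
    (ℱ : Filtration ℝ≥0 m) (P : Measure Ω)
    (w X : ℝ≥0 → Ω → EuclideanSpace ℝ (Fin n)) : Prop where
  adapted : Adapted ℱ X
  continuous : ∀ᵐ ω ∂P, Continuous fun t => X t ω
  eqn : ∀ᵐ ω ∂P, ∀ t : ℝ≥0, X t ω = X 0 ω +
    (∫ s in (0 : ℝ)..t, Matrix.toEuclideanCLM (𝕜 := ℝ) A (X s.toNNReal ω)) + w t ω

/-- The law of the change of state `X(t + h) - X(t)` conditioned on `X(t) = x`. -/
noncomputable def changeOfState {Ω : Type*} {m : MeasurableSpace Ω} (P : Measure Ω)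
    [IsFiniteMeasure P] (X : ℝ≥0 → Ω → EuclideanSpace ℝ (Fin n)) (t h : ℝ≥0) :
    Kernel (EuclideanSpace ℝ (Fin n)) (EuclideanSpace ℝ (Fin n)) :=
  condDistrib (fun ω => X (t + h) ω - X t ω) (X t) P

end LinSys

/-!
The statement splits into a probabilistic part, a matrix part and an information theoretic part.

**The change of state.** The noise `Z = X(t + h) - exp(hA) X(t)` accumulated over `[t, t + h]` is,
path by path, a limit of sums of `exp((h - τ)A)`-weighted increments of `w`
(`tendsto_sum_exp_increment`): over a step of length `δ` the integral equation and the flow of `A`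
differ by `o(δ)`, uniformly by compactness. The increments are independent Gaussian and independent
of the past, so the joint characteristic function of `X(t)` and `Z` is a limit of explicit
products whose exponents are Riemann sums of the Gramian. Thus `Z` is independent of `X(t)` with
law `N(0, W(h))`, which is the asserted conditional law.

**The Lyapunov equation.** `exp(tA)` decays, because `ℂⁿ` is spanned by generalized eigenvectors.
A solution of the homogeneous equation is constant along `V ↦ exp(tA) V exp(tAᵀ)`, hence zero, so
the Lyapunov operator is bijective. For the solution `V` one has
`W(h) = V - exp(hA) V exp(hAᵀ)` (`noiseGramian_eq`). This makes `W(h)` increase to `V` in the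
Loewner order.

**Rates.** No formula for the rate of a Gaussian source is used. If `X` and `Z` are independent, a
reproduction `Y` of `X + Z` yields the reproduction `Y - Z` of `X` with the same error, and the
data processing inequality shows that the information does not increase: adding independent noise,
or a constant, to a source does not decrease its rate (`rateDistortion_le_conv`). This gives the
independence of the mean, the monotonicity in `h` and the upper bound. Conversely a reproduction of
`X` is a reproduction of `X + Z` with the variance of `Z` added to the error
(`rateDistortion_conv_le`). Together with the convexity of the rate in the error and its finiteness
for positive error, obtained by quantization, this gives the limit for `D > 0`. For `D = 0` both
sides are infinite, unless the limit covariance vanishes.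
-/

namespace LinSys

/-! ### Divergence inequalities -/

section Divergence

open InformationTheory

variable {E F G : Type*} [MeasurableSpace E] [MeasurableSpace F] [MeasurableSpace G]

/-- The product of the marginals minimizes the divergence from the joint law among all products
`P.prod ν`: by the chain rule in the second coordinate the excess is `klDiv (Q ∘ₘ P) ν`. -/
lemma mutualInfo_le_klDiv [StandardBorelSpace E] [Nonempty E] (P : Measure E)
    [IsProbabilityMeasure P] (Q : Kernel E F) [IsMarkovKernel Q] (ν : Measure F)
    [IsProbabilityMeasure ν] :
    mutualInfo P Q ≤ klDiv (P ⊗ₘ Q) (P.prod ν) := by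
  set μ := (P ⊗ₘ Q).map Prod.swap with hμ
  have : IsProbabilityMeasure μ := Measure.isProbabilityMeasure_map (by fun_prop)
  have hfst : μ.fst = Q ∘ₘ P := by
    rw [hμ, Measure.fst_map_swap, Measure.snd_compProd]
  have hdis : (Q ∘ₘ P) ⊗ₘ μ.condKernel = μ := by
    rw [← hfst]; exact μ.disintegrate μ.condKernel
  have hswap (ρ : Measure F) [SFinite ρ] : P.prod ρ = (ρ ⊗ₘ Kernel.const F P).map Prod.swap := by
    rw [Measure.compProd_const, Measure.prod_swap]
  have hback : P ⊗ₘ Q = μ.map Prod.swap := by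
    rw [hμ, Measure.map_map (by fun_prop) (by fun_prop)]; simp
  calc mutualInfo P Q
      = klDiv (μ.map Prod.swap) (((Q ∘ₘ P) ⊗ₘ Kernel.const F P).map Prod.swap) := by
        rw [mutualInfo, hswap, ← hback]
    _ ≤ klDiv μ ((Q ∘ₘ P) ⊗ₘ Kernel.const F P) := klDiv_map_le _ _ (by fun_prop)
    _ ≤ klDiv (Q ∘ₘ P) ν +
          klDiv ((Q ∘ₘ P) ⊗ₘ μ.condKernel) ((Q ∘ₘ P) ⊗ₘ Kernel.const F P) := by
        rw [hdis]; exact le_add_self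
    _ = klDiv μ (ν ⊗ₘ Kernel.const F P) := by rw [← klDiv_compProd_eq_add, hdis]
    _ ≤ klDiv (P ⊗ₘ Q) (P.prod ν) := by
        rw [Measure.compProd_const, ← Measure.prod_swap, hμ]
        exact klDiv_map_le _ _ (by fun_prop)

/-- Adjoining to the input of two channels a variable that the channels ignore does not increase
the divergence of the joint laws: that variable can be sampled afterwards from its conditional
law given the input. -/
lemma klDiv_compProd_comap_fst_le [StandardBorelSpace F] [Nonempty F] (M : Measure (E × F))
    [IsProbabilityMeasure M] (Q Q' : Kernel E G) [IsMarkovKernel Q] [IsMarkovKernel Q'] :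
    klDiv (M ⊗ₘ Q.comap Prod.fst measurable_fst) (M ⊗ₘ Q'.comap Prod.fst measurable_fst) ≤
      klDiv (M.fst ⊗ₘ Q) (M.fst ⊗ₘ Q') := by
  let κ : Kernel (E × G) ((E × F) × G) :=
    (Kernel.id ×ₖ M.condKernel.comap Prod.fst measurable_fst).map
      fun p => ((p.1.1, p.2), p.1.2)
  have hκ : IsMarkovKernel κ := Kernel.IsMarkovKernel.map _ (by fun_prop)
  have key (R : Kernel E G) [IsMarkovKernel R] :
      κ ∘ₘ (M.fst ⊗ₘ R) = M ⊗ₘ R.comap Prod.fst measurable_fst := by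
    refine Measure.ext_of_lintegral _ fun f hf => ?_
    rw [Measure.lintegral_bind κ.aemeasurable hf.aemeasurable]
    have h1 (z : E × G) : ∫⁻ y, f y ∂(κ z) = ∫⁻ y, f ((z.1, y), z.2) ∂(M.condKernel z.1) := by
      rw [Kernel.lintegral_map _ (by fun_prop) _ hf, Kernel.lintegral_id_prod (by fun_prop)]
      rfl
    simp_rw [h1]
    rw [Measure.lintegral_compProd
      (f := fun z : E × G => ∫⁻ y, f ((z.1, y), z.2) ∂(M.condKernel z.1))]
    swap
    · exact Measurable.lintegral_kernel_prod_right'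
        (κ := M.condKernel.comap Prod.fst measurable_fst)
        (f := fun p : (E × G) × F => f ((p.1.1, p.2), p.1.2)) (by fun_prop)
    rw [Measure.lintegral_compProd hf]
    rw [← Measure.lintegral_condKernel (ρ := M)]
    swap
    · exact Measurable.lintegral_kernel_prod_right' (κ := R.comap Prod.fst measurable_fst)
        (f := fun p : (E × F) × G => f p) hf
    refine lintegral_congr fun x => ?_
    simp only [Kernel.comap_apply]
    exact lintegral_lintegral_swap (by fun_prop)
  rw [← key Q, ← key Q']
  exact klDiv_comp_right_le _ _ κ

lemma lintegral_map_compProd_comap_fst {Ω : Type*} [MeasurableSpace Ω] (τ : Measure Ω) [SFinite τ]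
    {φ : Ω → E × F} (hφ : Measurable φ) (Q : Kernel E G) [IsSFiniteKernel Q]
    {f : (E × F) × G → ℝ≥0∞} (hf : Measurable f) :
    ∫⁻ p, f p ∂(τ.map φ ⊗ₘ Q.comap Prod.fst measurable_fst) =
      ∫⁻ z, ∫⁻ y, f (φ z, y) ∂(Q (φ z).1) ∂τ := by
  rw [Measure.lintegral_compProd hf, lintegral_map _ hφ]
  · rfl
  · exact Measurable.lintegral_kernel_prod_right' (κ := Q.comap Prod.fst measurable_fst) hf

lemma mutualInfo_eq (P : Measure E) [SFinite P] (Q : Kernel E F) [IsSFiniteKernel Q] :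
    mutualInfo P Q = klDiv (P ⊗ₘ Q) (P ⊗ₘ Kernel.const E (Q ∘ₘ P)) := by
  rw [mutualInfo, Measure.compProd_const]

/-- The divergence is subadditive. -/
lemma klDiv_add_le (μ₀ μ₁ ν₀ ν₁ : Measure E) [IsFiniteMeasure μ₀] [IsFiniteMeasure μ₁]
    [IsFiniteMeasure ν₀] [IsFiniteMeasure ν₁] :
    klDiv (μ₀ + μ₁) (ν₀ + ν₁) ≤ klDiv μ₀ ν₀ + klDiv μ₁ ν₁ := by
  by_cases h₀ : μ₀ ≪ ν₀
  swap; · simp [klDiv_of_not_ac h₀]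
  by_cases h₁ : μ₁ ≪ ν₁
  swap; · simp [klDiv_of_not_ac h₁]
  set ν := ν₀ + ν₁ with hν
  have a₀ : ν₀ ≪ ν := Measure.AbsolutelyContinuous.rfl.add_right _
  have a₁ : ν₁ ≪ ν := by rw [hν, add_comm]; exact Measure.AbsolutelyContinuous.rfl.add_right _
  have hac : μ₀ + μ₁ ≪ ν := Measure.AbsolutelyContinuous.add h₀ h₁
  rw [klDiv_eq_lintegral_klFun_of_ac hac, klDiv_eq_lintegral_klFun_of_ac h₀,
    klDiv_eq_lintegral_klFun_of_ac h₁, ← lintegral_rnDeriv_mul a₀ (by fun_prop),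
    ← lintegral_rnDeriv_mul a₁ (by fun_prop), ← lintegral_add_left (by fun_prop)]
  have hsum : ν₀.rnDeriv ν + ν₁.rnDeriv ν =ᵐ[ν] 1 := by
    filter_upwards [Measure.rnDeriv_add ν₀ ν₁ ν, Measure.rnDeriv_self ν] with x hx hx'
    rw [← hx, ← hν, hx']; rfl
  refine lintegral_mono_ae ?_
  filter_upwards [hsum, Measure.rnDeriv_add μ₀ μ₁ ν, Measure.rnDeriv_mul_rnDeriv (κ := ν) h₀,
    Measure.rnDeriv_mul_rnDeriv (κ := ν) h₁, ν₀.rnDeriv_lt_top ν, ν₁.rnDeriv_lt_top ν,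
    μ₀.rnDeriv_lt_top ν, μ₁.rnDeriv_lt_top ν] with x hx hadd hm₀ hm₁ hg₀ hg₁ hf₀ hf₁
  simp only [Pi.add_apply, Pi.mul_apply, Pi.one_apply] at hx hadd hm₀ hm₁
  have hx' : (ν₀.rnDeriv ν x).toReal + (ν₁.rnDeriv ν x).toReal = 1 := by
    rw [← ENNReal.toReal_add hg₀.ne hg₁.ne, hx, ENNReal.toReal_one]
  have hconv := convexOn_klFun.2 (x := (μ₀.rnDeriv ν₀ x).toReal) (y := (μ₁.rnDeriv ν₁ x).toReal)
    ENNReal.toReal_nonneg ENNReal.toReal_nonneg ENNReal.toReal_nonneg ENNReal.toReal_nonneg hx'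
  simp only [smul_eq_mul] at hconv
  rw [hadd, ENNReal.toReal_add hf₀.ne hf₁.ne, ← hm₀, ← hm₁, ENNReal.toReal_mul,
    ENNReal.toReal_mul, mul_comm (μ₀.rnDeriv ν₀ x).toReal, mul_comm (μ₁.rnDeriv ν₁ x).toReal]
  refine (ENNReal.ofReal_le_ofReal hconv).trans (ENNReal.ofReal_add_le.trans_eq ?_)
  rw [ENNReal.ofReal_mul ENNReal.toReal_nonneg, ENNReal.ofReal_mul ENNReal.toReal_nonneg,
    ENNReal.ofReal_toReal hg₀.ne, ENNReal.ofReal_toReal hg₁.ne]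

/-- A measure dominated by a multiple of a finite measure has finite divergence from it, because
its density is bounded. -/
lemma klDiv_ne_top_of_le_smul {μ ν : Measure E} [IsFiniteMeasure μ] [IsFiniteMeasure ν] (c : ℝ≥0)
    (h : μ ≤ c • ν) : klDiv μ ν ≠ ∞ := by
  have hac : μ ≪ ν := (Measure.absolutelyContinuous_of_le h).trans
    (Measure.AbsolutelyContinuous.rfl.smul_left c)
  have hbd : ∀ᵐ x ∂ν, μ.rnDeriv ν x ≤ c := by
    refine ae_le_of_forall_setLIntegral_le_of_sigmaFinite (by fun_prop) fun s hs _ => ?_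
    rw [Measure.setLIntegral_rnDeriv hac, setLIntegral_const]
    exact h s
  rw [klDiv_eq_lintegral_klFun_of_ac hac]
  obtain ⟨C, hC⟩ := (isCompact_Icc (a := (0 : ℝ)) (b := c)).bddAbove_image
    continuous_klFun.continuousOn
  have hle : ∫⁻ x, ENNReal.ofReal (klFun (μ.rnDeriv ν x).toReal) ∂ν ≤
      ∫⁻ _, ENNReal.ofReal C ∂ν := by
    refine lintegral_mono_ae ?_
    filter_upwards [hbd] with x hx
    refine ENNReal.ofReal_le_ofReal (hC ⟨_, ⟨ENNReal.toReal_nonneg, ?_⟩, rfl⟩)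
    exact ENNReal.toReal_le_coe_of_le_coe hx
  refine (hle.trans_lt ?_).ne
  rw [lintegral_const]
  exact ENNReal.mul_lt_top ENNReal.ofReal_lt_top (measure_lt_top _ _)

end Divergence

/-! ### Rate distortion functions -/

section Joint

open InformationTheory

variable {E : Type*} [NormedAddCommGroup E] [MeasurableSpace E]

lemma rateDistortion_anti (P : Measure E) {D D' : ℝ≥0} (h : D ≤ D') :
    rateDistortion P D' ≤ rateDistortion P D :=
  iInf_mono fun _ => iInf_mono fun _ => iInf_mono' fun hQ =>
    ⟨hQ.trans (ENNReal.coe_le_coe.2 h), le_rfl⟩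

lemma exists_mutualInfo_lt {P : Measure E} {D : ℝ≥0} {c : ℝ≥0∞} (h : rateDistortion P D < c) :
    ∃ Q : Kernel E E, IsMarkovKernel Q ∧ meanSquareError P Q ≤ D ∧ mutualInfo P Q < c := by
  simp only [rateDistortion, iInf_lt_iff] at h
  obtain ⟨Q, h₁, h₂, h₃⟩ := h
  exact ⟨Q, h₁, h₂, h₃⟩

/-- Every joint law of source and reproduction with mean square error at most `D` bounds the rate,
through its divergence from any product with the source law as first factor. -/
lemma rateDistortion_le_klDiv [StandardBorelSpace E] {P ν : Measure E} [IsProbabilityMeasure P]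
    [IsProbabilityMeasure ν] {D : ℝ≥0} (μ : Measure (E × E)) [IsFiniteMeasure μ] (hfst : μ.fst = P)
    (hD : ∫⁻ z, ‖z.1 - z.2‖ₑ ^ 2 ∂μ ≤ D) :
    rateDistortion P D ≤ klDiv μ (P.prod ν) := by
  have hdis : P ⊗ₘ μ.condKernel = μ := by rw [← hfst]; exact μ.disintegrate μ.condKernel
  refine (iInf_le_of_le μ.condKernel <|
    iInf_le_of_le (inferInstance : IsMarkovKernel μ.condKernel) <| iInf_le_of_le ?_ ?_).trans
    ((mutualInfo_le_klDiv P μ.condKernel ν).trans_eq (by rw [hdis]))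
  · rwa [meanSquareError, hdis]
  · exact le_rfl

/-- The rate distortion function is convex: mix the two joint laws. -/
theorem rateDistortion_convex [StandardBorelSpace E] [SecondCountableTopology E]
    [OpensMeasurableSpace E] (P : Measure E) [IsProbabilityMeasure P] (D₀ D₁ : ℝ≥0) {a b : ℝ≥0}
    (hab : a + b = 1) (ha : a ≠ 0) (hb : b ≠ 0) :
    rateDistortion P (a * D₀ + b * D₁) ≤ a * rateDistortion P D₀ + b * rateDistortion P D₁ := by
  by_cases h₀ : rateDistortion P D₀ = ∞
  · simp [h₀, ENNReal.mul_top (ENNReal.coe_ne_zero.2 ha)]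
  by_cases h₁ : rateDistortion P D₁ = ∞
  · simp [h₁, ENNReal.mul_top (ENNReal.coe_ne_zero.2 hb)]
  refine ENNReal.le_of_forall_pos_le_add fun ε hε _ => ?_
  have hε' : (ε : ℝ≥0∞) ≠ 0 := ENNReal.coe_ne_zero.2 hε.ne'
  obtain ⟨Q₀, _, hD₀, hI₀⟩ := exists_mutualInfo_lt (ENNReal.lt_add_right h₀ hε')
  obtain ⟨Q₁, _, hD₁, hI₁⟩ := exists_mutualInfo_lt (ENNReal.lt_add_right h₁ hε')
  have hab' : (a : ℝ≥0∞) + b = 1 := by exact_mod_cast hab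
  set ν : Measure E := a • (Q₀ ∘ₘ P) + b • (Q₁ ∘ₘ P)
  have : IsProbabilityMeasure ν := ⟨by
    rw [Measure.add_apply, Measure.smul_apply, Measure.smul_apply, measure_univ, measure_univ,
      ENNReal.smul_def, ENNReal.smul_def, smul_eq_mul, smul_eq_mul, mul_one, mul_one, hab']⟩
  have hν : P.prod ν = a • P.prod (Q₀ ∘ₘ P) + b • P.prod (Q₁ ∘ₘ P) := by
    rw [Measure.prod_add, ENNReal.smul_def, ENNReal.smul_def, ENNReal.smul_def, ENNReal.smul_def,
      Measure.prod_smul_right, Measure.prod_smul_right]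
  calc rateDistortion P (a * D₀ + b * D₁)
      ≤ klDiv (a • (P ⊗ₘ Q₀) + b • (P ⊗ₘ Q₁)) (P.prod ν) := by
        refine rateDistortion_le_klDiv _ ?_ ?_
        · rw [Measure.fst_add, Measure.fst, Measure.fst, Measure.map_smul, Measure.map_smul]
          change a • (P ⊗ₘ Q₀).fst + b • (P ⊗ₘ Q₁).fst = P
          rw [Measure.fst_compProd, Measure.fst_compProd, ← add_smul, hab, one_smul]
        · rw [lintegral_add_measure, lintegral_smul_measure, lintegral_smul_measure,
            ENNReal.smul_def, ENNReal.smul_def, smul_eq_mul, smul_eq_mul]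
          push_cast
          gcongr
          · exact hD₀
          · exact hD₁
    _ ≤ a * mutualInfo P Q₀ + b * mutualInfo P Q₁ := by
        rw [hν]
        refine (klDiv_add_le _ _ _ _).trans_eq ?_
        rw [klDiv_smul_same, klDiv_smul_same]; rfl
    _ ≤ a * (rateDistortion P D₀ + ε) + b * (rateDistortion P D₁ + ε) := by gcongr
    _ = a * rateDistortion P D₀ + b * rateDistortion P D₁ + (a + b) * ε := by ring
    _ = a * rateDistortion P D₀ + b * rateDistortion P D₁ + ε := by rw [hab', one_mul]

end Joint

section Rate

open InformationTheory

variable {E : Type*} [NormedAddCommGroup E] [MeasurableSpace E] [BorelSpace E]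
  [SecondCountableTopology E] [StandardBorelSpace E]

/-- If the source is `X + Z` with `X` and `Z` independent, a reproduction `Y` of `X + Z` yields the
reproduction `Y - Z` of `X`, with the same error. Hence adding independent noise to a source does
not decrease the rate. -/
theorem rateDistortion_le_conv (P ρ : Measure E) [IsProbabilityMeasure P] [IsProbabilityMeasure ρ]
    (D : ℝ≥0) : rateDistortion P D ≤ rateDistortion (P ∗ ρ) D := by
  refine le_iInf fun Q => le_iInf fun _ => le_iInf fun hD => ?_
  -- the joint law of `X + Z` and `(X, Z)`
  set M : Measure (E × (E × E)) := (P.prod ρ).map fun z => (z.1 + z.2, z) with hM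
  have : IsProbabilityMeasure M := Measure.isProbabilityMeasure_map (by fun_prop)
  have hMfst : M.fst = P ∗ ρ := by
    rw [hM, Measure.fst, Measure.map_map (by fun_prop) (by fun_prop)]; rfl
  set ν : Measure E := Q ∘ₘ (P ∗ ρ) with hν
  -- from `((X + Z, (X, Z)), Y)` to the source `X` and its reproduction `Y - Z`
  let g : (E × (E × E)) × E → E × E := fun p => (p.1.2.1, p.2 - p.1.2.2)
  have hg : Measurable g := by fun_prop
  have hprod : (M ⊗ₘ (Kernel.const E ν).comap Prod.fst measurable_fst).map g =
      P.prod ((ρ.prod ν).map fun z => z.2 - z.1) := by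
    refine Measure.ext_of_lintegral _ fun f hf => ?_
    rw [lintegral_map hf hg, lintegral_map_compProd_comap_fst _ (by fun_prop) _ (by fun_prop)]
    simp only [Kernel.const_apply]
    rw [lintegral_prod _ (Measurable.lintegral_prod_right' (ν := ν)
        (f := fun p : (E × E) × E => f (g ((p.1.1 + p.1.2, p.1), p.2))) (by fun_prop)).aemeasurable,
      lintegral_prod _ (by fun_prop)]
    refine lintegral_congr fun x => ?_
    rw [lintegral_map (by fun_prop) (by fun_prop), lintegral_prod _ (by fun_prop)]
  set μ := (M ⊗ₘ Q.comap Prod.fst measurable_fst).map g with hμ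
  have : IsProbabilityMeasure μ := Measure.isProbabilityMeasure_map (by fun_prop)
  have : IsProbabilityMeasure ((ρ.prod ν).map fun z => z.2 - z.1) :=
    Measure.isProbabilityMeasure_map (by fun_prop)
  calc rateDistortion P D ≤ klDiv μ (P.prod ((ρ.prod ν).map fun z => z.2 - z.1)) := by
        refine rateDistortion_le_klDiv μ ?_ (le_trans (le_of_eq ?_) hD)
        · rw [hμ, Measure.fst, Measure.map_map (by fun_prop) hg,
            show Prod.fst ∘ g = (fun p => p.2.1) ∘ Prod.fst from rfl,
            ← Measure.map_map (by fun_prop) (by fun_prop),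
            show Measure.map Prod.fst _ = Measure.fst _ from rfl, Measure.fst_compProd, hM,
            Measure.map_map (by fun_prop) (by fun_prop)]
          exact Measure.fst_prod
        · rw [hμ, lintegral_map (by fun_prop) hg, meanSquareError, ← hMfst, Measure.fst,
            lintegral_map_compProd_comap_fst _ (by fun_prop) _ (by fun_prop), hM,
            Measure.map_map (by fun_prop) (by fun_prop), Measure.lintegral_compProd (by fun_prop),
            lintegral_map (Measurable.lintegral_kernel_prod_right'
              (f := fun z : E × E => ‖z.1 - z.2‖ₑ ^ 2) (by fun_prop)) (by fun_prop)]
          refine lintegral_congr fun z => lintegral_congr fun y => ?_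
          simp only [g, Function.comp]
          congr 2; abel
    _ ≤ klDiv (M ⊗ₘ Q.comap Prod.fst measurable_fst)
          (M ⊗ₘ (Kernel.const E ν).comap Prod.fst measurable_fst) := by
        rw [← hprod]; exact klDiv_map_le _ _ hg
    _ ≤ mutualInfo (P ∗ ρ) Q := by
        rw [mutualInfo_eq, ← hν, ← hMfst]; exact klDiv_compProd_comap_fst_le M _ _

/-- A source with a second moment can be reproduced with any positive error at a finite rate:
quantize it to finitely many values. -/
theorem rateDistortion_ne_top {P : Measure E} [IsProbabilityMeasure P] (hP : MemLp id 2 P)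
    {D : ℝ≥0} (hD : 0 < D) : rateDistortion P D ≠ ∞ := by
  obtain ⟨g, hg, -⟩ := hP.exists_simpleFunc_eLpNorm_sub_lt (by simp)
    (ε := ((NNReal.sqrt D : ℝ≥0) : ℝ≥0∞)) (by simpa using hD.ne')
  obtain ⟨x₀⟩ : Nonempty E := inferInstance
  have hK : g.range.Nonempty := ⟨g x₀, g.mem_range_self x₀⟩
  set ν : Measure E := (PMF.uniformOfFinset g.range hK).toMeasure
  have hν (x : E) : ν {g x} = (g.range.card : ℝ≥0∞)⁻¹ := by
    rw [PMF.toMeasure_apply_singleton _ _ (measurableSet_singleton _),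
      PMF.uniformOfFinset_apply_of_mem _ (g.mem_range_self x)]
  have hgm : Measurable fun x => (x, g x) := measurable_id.prodMk g.measurable
  set μ : Measure (E × E) := P.map fun x => (x, g x) with hμ
  have : IsProbabilityMeasure μ := Measure.isProbabilityMeasure_map hgm.aemeasurable
  have hcard : (g.range.card : ℝ≥0∞) ≠ 0 := by simpa using hK.ne_empty
  have hle : μ ≤ (g.range.card : ℝ≥0) • P.prod ν := by
    refine Measure.le_iff.2 fun s hs => ?_
    rw [Measure.smul_apply, Measure.prod_apply hs, hμ, Measure.map_apply hgm hs,
      ENNReal.smul_def, smul_eq_mul, ENNReal.coe_natCast,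
      ← lintegral_const_mul _ (measurable_measure_prodMk_left hs),
      ← lintegral_indicator_one (hgm hs)]
    refine lintegral_mono fun x => ?_
    by_cases hx : x ∈ (fun x => (x, g x)) ⁻¹' s
    · rw [Set.indicator_of_mem hx, Pi.one_apply,
        ← ENNReal.mul_inv_cancel hcard (ENNReal.natCast_ne_top _), ← hν x]
      gcongr
      simpa using hx
    · simp [Set.indicator_of_notMem hx]
  refine ne_top_of_le_ne_top (klDiv_ne_top_of_le_smul _ hle)
    (rateDistortion_le_klDiv μ ?_ ?_)
  · rw [hμ, Measure.fst, Measure.map_map (by fun_prop) hgm]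
    exact Measure.map_id
  · rw [hμ, lintegral_map (by fun_prop) hgm]
    have h := hg.le
    rw [eLpNorm_eq_lintegral_rpow_enorm_toReal (by simp) (by simp)] at h
    have h' := ENNReal.rpow_le_rpow h (zero_le_two (α := ℝ))
    rw [← ENNReal.rpow_mul] at h'
    simp only [ENNReal.toReal_ofNat, one_div, ENNReal.rpow_ofNat] at h'
    norm_num at h'
    refine h'.trans_eq ?_
    norm_cast
    simp

/-- An error of zero forces the reproduction to equal the source, and the joint law of two equal
variables is carried by the diagonal, which is null for the product law if there are no atoms. -/
theorem rateDistortion_zero_eq_top (P : Measure E) [IsProbabilityMeasure P] [NullSingletonClass P] :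
    rateDistortion P 0 = ∞ := by
  refine iInf_eq_top.2 fun Q => iInf_eq_top.2 fun _ => iInf_eq_top.2 fun hD => ?_
  refine klDiv_of_not_ac fun hac => ?_
  have hdiag : P.prod (Q ∘ₘ P) (Set.diagonal E) = 0 := by
    rw [Measure.prod_apply_symm measurableSet_diagonal]
    simp [Set.preimage, Set.diagonal]
  have h0 : ∫⁻ z, ‖z.1 - z.2‖ₑ ^ 2 ∂(P ⊗ₘ Q) = 0 := by
    simpa [meanSquareError] using hD
  rw [lintegral_eq_zero_iff (by fun_prop)] at h0
  have hne : ∀ᵐ z ∂(P ⊗ₘ Q), z ∉ Set.diagonal E := measure_eq_zero_iff_ae_notMem.1 (hac hdiag)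
  have : ∀ᵐ z ∂(P ⊗ₘ Q), False := by
    filter_upwards [h0, hne] with z hz hz'
    simp [sub_eq_zero] at hz
    exact hz' hz
  simp only [eventually_false_iff_eq_bot, ae_eq_bot] at this
  exact IsProbabilityMeasure.ne_zero _ this

end Rate

section Noise

lemma lintegral_enorm_add_sq {E : Type*} [NormedAddCommGroup E] [InnerProductSpace ℝ E]
    [CompleteSpace E] [MeasurableSpace E] {ρ : Measure E} [IsProbabilityMeasure ρ]
    (hρ : MemLp id 2 ρ) (h0 : ∫ z, z ∂ρ = 0) (v : E) :
    ∫⁻ z, ‖v + z‖ₑ ^ 2 ∂ρ = ‖v‖ₑ ^ 2 + ∫⁻ z, ‖z‖ₑ ^ 2 ∂ρ := by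
  have hsq (x : E) : ‖x‖ₑ ^ 2 = ENNReal.ofReal (‖x‖ ^ 2) := by
    rw [← ofReal_norm, ENNReal.ofReal_pow (norm_nonneg x)]
  have hint : Integrable (fun z : E => z) ρ := hρ.integrable (by norm_num)
  have hint2 : Integrable (fun z : E => ‖z‖ ^ 2) ρ := hρ.integrable_norm_pow (by norm_num)
  have hin : Integrable (fun z : E => inner ℝ v z) ρ := hint.const_inner v
  have hin0 : ∫ z, inner ℝ v z ∂ρ = 0 := by rw [integral_inner hint, h0, inner_zero_right]
  have hexp (z : E) : ‖v + z‖ ^ 2 = ‖v‖ ^ 2 + 2 * inner ℝ v z + ‖z‖ ^ 2 := norm_add_sq_real v z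
  have hi1 : Integrable (fun z : E => ‖v‖ ^ 2 + 2 * inner ℝ v z) ρ :=
    (integrable_const _).add (hin.const_mul 2)
  simp_rw [hsq]
  rw [← ofReal_integral_eq_lintegral_ofReal hint2 (by filter_upwards with z; positivity),
    ← ofReal_integral_eq_lintegral_ofReal _ (by filter_upwards with z; positivity),
    ← ENNReal.ofReal_add (by positivity) (integral_nonneg fun z => by positivity)]
  · congr 1
    simp_rw [hexp]
    rw [integral_add hi1 hint2, integral_add (integrable_const _) (hin.const_mul 2),
      integral_const_mul, hin0]
    simp
  · simp_rw [hexp]; exact hi1.add hint2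

open InformationTheory

variable {E : Type*} [NormedAddCommGroup E] [InnerProductSpace ℝ E] [MeasurableSpace E]
  [BorelSpace E] [SecondCountableTopology E] [StandardBorelSpace E]

/-- A reproduction of `X` also reproduces `X + Z` when `Z` is independent centred noise; the
variance of the noise adds to the error, and the information does not increase. -/
theorem rateDistortion_conv_le [CompleteSpace E] (P ρ : Measure E) [IsProbabilityMeasure P]
    [IsProbabilityMeasure ρ] (hρ : MemLp id 2 ρ) (h0 : ∫ z, z ∂ρ = 0) {δ : ℝ≥0}
    (hδ : ∫⁻ z, ‖z‖ₑ ^ 2 ∂ρ ≤ δ) (D : ℝ≥0) :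
    rateDistortion (P ∗ ρ) (D + δ) ≤ rateDistortion P D := by
  refine le_iInf fun Q => le_iInf fun _ => le_iInf fun hD => ?_
  set ν : Measure E := Q ∘ₘ P with hν
  -- from `((X, Z), Y)` to the source `X + Z` and its reproduction `Y`
  let g : (E × E) × E → E × E := fun p => (p.1.1 + p.1.2, p.2)
  have hg : Measurable g := by fun_prop
  have hprod : (P.prod ρ ⊗ₘ (Kernel.const E ν).comap Prod.fst measurable_fst).map g =
      (P ∗ ρ).prod ν := by
    rw [show (Kernel.const E ν).comap Prod.fst measurable_fst = Kernel.const (E × E) ν from rfl,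
      Measure.compProd_const, Measure.conv]
    nth_rw 2 [← Measure.map_id (μ := ν)]
    rw [Measure.map_prod_map _ _ (by fun_prop) (by fun_prop)]
    rfl
  set μ := (P.prod ρ ⊗ₘ Q.comap Prod.fst measurable_fst).map g with hμ
  calc rateDistortion (P ∗ ρ) (D + δ) ≤ klDiv μ ((P ∗ ρ).prod ν) := by
        refine rateDistortion_le_klDiv μ ?_ ?_
        · rw [hμ, Measure.fst, Measure.map_map (by fun_prop) hg,
            show Prod.fst ∘ g = (fun p => p.1 + p.2) ∘ Prod.fst from rfl,
            ← Measure.map_map (by fun_prop) (by fun_prop),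
            show Measure.map Prod.fst _ = Measure.fst _ from rfl, Measure.fst_compProd]
          rfl
        · have hcomm : ∫⁻ z, ‖z.1 - z.2‖ₑ ^ 2 ∂μ =
              ∫⁻ p, ∫⁻ z, ‖p.1 - p.2 + z‖ₑ ^ 2 ∂ρ ∂(P ⊗ₘ Q) := by
            rw [hμ, lintegral_map (by fun_prop) hg, Measure.lintegral_compProd (by fun_prop),
              lintegral_prod _ (Measurable.lintegral_kernel_prod_right'
                (κ := Q.comap Prod.fst measurable_fst)
                (f := fun p : (E × E) × E => ‖(g p).1 - (g p).2‖ₑ ^ 2) (by fun_prop)).aemeasurable,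
              Measure.lintegral_compProd
                (Measurable.lintegral_prod_right'
                  (f := fun p : (E × E) × E => ‖p.1.1 - p.1.2 + p.2‖ₑ ^ 2) (by fun_prop))]
            refine lintegral_congr fun x => ?_
            simp only [Kernel.comap_apply, g]
            rw [lintegral_lintegral_swap (by fun_prop)]
            refine lintegral_congr fun y => lintegral_congr fun z => ?_
            congr 2; abel
          rw [hcomm]
          simp_rw [lintegral_enorm_add_sq hρ h0]
          rw [lintegral_add_right _ measurable_const, lintegral_const, measure_univ, mul_one]
          push_cast
          exact add_le_add hD hδ
    _ ≤ klDiv (P.prod ρ ⊗ₘ Q.comap Prod.fst measurable_fst)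
          (P.prod ρ ⊗ₘ (Kernel.const E ν).comap Prod.fst measurable_fst) := by
        rw [← hprod]; exact klDiv_map_le _ _ hg
    _ ≤ mutualInfo P Q := by
        rw [mutualInfo_eq, ← hν]
        have h := klDiv_compProd_comap_fst_le (P.prod ρ) Q (Kernel.const E ν)
        rwa [Measure.fst_prod] at h

end Noise

/-! ### Exponential decay of Hurwitz matrices -/

section Decay

open scoped Matrix.Norms.Operator
open NormedSpace

variable {n : ℕ}

/-- On a generalized eigenvector of `C` the flow `exp(tC)` is `exp(tz)` times a polynomial. -/
lemma exp_smul_mulVec_of_pow_mulVec_eq_zero (C : Matrix (Fin n) (Fin n) ℂ) (z : ℂ) (k : ℕ)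
    (v : Fin n → ℂ) (hv : (C - z • 1) ^ k *ᵥ v = 0) (t : ℝ) :
    exp (t • C) *ᵥ v = ∑ j ∈ Finset.range k,
      ((t ^ j * Complex.exp (t * z) : ℂ) * (j.factorial : ℂ)⁻¹) • ((C - z • 1) ^ j *ᵥ v) := by
  set B := C - z • (1 : Matrix (Fin n) (Fin n) ℂ) with hB
  have hsplit : t • C = algebraMap ℂ (Matrix (Fin n) (Fin n) ℂ) (t * z) + (t : ℂ) • B := by
    rw [hB, Algebra.algebraMap_eq_smul_one, smul_sub, smul_smul]
    rw [show (t : ℂ) • C = t • C from Complex.coe_smul t C]; abel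
  have hexp : exp (t • C) = Complex.exp (t * z) • exp ((t : ℂ) • B) := by
    have hscalar : exp (algebraMap ℂ (Matrix (Fin n) (Fin n) ℂ) (t * z)) =
        algebraMap ℂ (Matrix (Fin n) (Fin n) ℂ) (exp (t * z)) := (algebraMap_exp_comm _).symm
    rw [hsplit, Matrix.exp_add_of_commute _ _ (Algebra.commute_algebraMap_left _ _), hscalar,
      Algebra.algebraMap_eq_smul_one, smul_mul_assoc, one_mul, Complex.exp_eq_exp_ℂ]
  have hsum : HasSum (fun j : ℕ => ((j.factorial : ℂ)⁻¹ • ((t : ℂ) • B) ^ j) *ᵥ v)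
      (exp ((t : ℂ) • B) *ᵥ v) :=
    (exp_series_hasSum_exp' (𝕂 := ℂ) ((t : ℂ) • B)).map
      (⟨⟨fun M => M *ᵥ v, Matrix.zero_mulVec v⟩, fun M M' => Matrix.add_mulVec M M' v⟩ :
        Matrix (Fin n) (Fin n) ℂ →+ (Fin n → ℂ)) (by
          change Continuous fun M : Matrix (Fin n) (Fin n) ℂ => M *ᵥ v
          fun_prop)
  have hzero (j : ℕ) (hj : j ∉ Finset.range k) :
      ((j.factorial : ℂ)⁻¹ • ((t : ℂ) • B) ^ j) *ᵥ v = 0 := by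
    obtain ⟨i, rfl⟩ := Nat.exists_eq_add_of_le (not_lt.1 (Finset.mem_range.not.1 hj))
    rw [smul_pow, add_comm k i, pow_add B, Matrix.smul_mulVec, Matrix.smul_mulVec,
      ← Matrix.mulVec_mulVec, hv, Matrix.mulVec_zero, smul_zero, smul_zero]
  rw [hexp, Matrix.smul_mulVec, hsum.unique (hasSum_sum_of_ne_finset_zero hzero),
    Finset.smul_sum]
  refine Finset.sum_congr rfl fun j _ => ?_
  rw [smul_pow, Matrix.smul_mulVec, Matrix.smul_mulVec, smul_smul, smul_smul]
  congr 1; ring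

lemma tendsto_pow_mul_cexp_atTop {z : ℂ} (hz : z.re < 0) (j : ℕ) :
    Tendsto (fun t : ℝ => (t ^ j * Complex.exp (t * z) : ℂ)) atTop (𝓝 0) := by
  rw [tendsto_zero_iff_norm_tendsto_zero]
  refine (tendsto_rpow_mul_exp_neg_mul_atTop_nhds_zero j (-z.re) (by linarith)).congr' ?_
  filter_upwards [eventually_ge_atTop 0] with t ht
  rw [norm_mul, norm_pow, Complex.norm_real, Real.norm_of_nonneg ht, Complex.norm_exp,
    Real.rpow_natCast]
  congr 2
  simp [mul_comm]

/-- The generalized eigenspaces span, so the flow of a complex matrix whose eigenvalues have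
negative real part decays on every vector. -/
lemma tendsto_exp_smul_mulVec (C : Matrix (Fin n) (Fin n) ℂ) (hC : ∀ z ∈ spectrum ℂ C, z.re < 0)
    (v : Fin n → ℂ) : Tendsto (fun t : ℝ => exp (t • C) *ᵥ v) atTop (𝓝 0) := by
  let S : Submodule ℂ (Fin n → ℂ) :=
    { carrier := {v | Tendsto (fun t : ℝ => exp (t • C) *ᵥ v) atTop (𝓝 0)}
      add_mem' := fun {a b} ha hb => by
        simpa [Matrix.mulVec_add] using ha.add hb
      zero_mem' := by simp
      smul_mem' := fun c a ha => by
        simpa [Matrix.mulVec_smul] using ha.const_smul c }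
  suffices hS : S = ⊤ by
    have : v ∈ S := hS ▸ Submodule.mem_top
    exact this
  rw [eq_top_iff, ← Module.End.iSup_maxGenEigenspace_eq_top (Matrix.toLin' C)]
  refine iSup_le fun z => ?_
  intro v hv
  by_cases hz : z ∈ spectrum ℂ C
  · obtain ⟨k, hk⟩ := (Module.End.mem_maxGenEigenspace _ _ _).1 hv
    have hk' : (C - z • 1) ^ k *ᵥ v = 0 := by
      rw [← hk, ← Matrix.toLin'_apply, Matrix.toLin'_pow, map_sub, map_smul, Matrix.toLin'_one]
      rfl
    change Tendsto (fun t : ℝ => exp (t • C) *ᵥ v) atTop (𝓝 0)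
    simp_rw [exp_smul_mulVec_of_pow_mulVec_eq_zero C z k v hk']
    rw [← Finset.sum_const_zero (s := Finset.range k)]
    refine tendsto_finsetSum _ fun j _ => ?_
    have := ((tendsto_pow_mul_cexp_atTop (hC z hz) j).mul_const ((j.factorial : ℂ)⁻¹)).smul_const
      ((C - z • 1) ^ j *ᵥ v)
    simpa using this
  · have : Module.End.maxGenEigenspace (Matrix.toLin' C) z = ⊥ := by
      rw [← Matrix.spectrum_toLin', ← Module.End.hasEigenvalue_iff_mem_spectrum] at hz
      by_contra hne
      exact hz ((Module.End.hasUnifEigenvalue_iff_hasUnifEigenvalue_one (k := ⊤) (by simp)).1 hne)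
    rw [this, Submodule.mem_bot] at hv
    rw [hv]; exact S.zero_mem

/-- The flow of a Hurwitz matrix decays. -/
theorem IsHurwitz.tendsto_exp {A : Matrix (Fin n) (Fin n) ℝ} (hA : IsHurwitz A) :
    Tendsto (fun t : ℝ => exp (t • A)) atTop (𝓝 0) := by
  set C := A.map (fun r : ℝ => (r : ℂ)) with hC
  have hmap (t : ℝ) : (exp (t • A)).map (fun r : ℝ => (r : ℂ)) = exp (t • C) := by
    have h := map_exp (RingHom.mapMatrix (m := Fin n) Complex.ofRealHom)
      (by
        change Continuous fun M : Matrix (Fin n) (Fin n) ℝ => M.map Complex.ofReal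
        exact continuous_id.matrix_map Complex.continuous_ofReal) (t • A)
    have h2 : RingHom.mapMatrix (m := Fin n) Complex.ofRealHom (t • A) = t • C := by
      ext i j; simp [C]
    rw [h2] at h
    exact h
  refine tendsto_pi_nhds.2 fun i => tendsto_pi_nhds.2 fun j => ?_
  have h := tendsto_pi_nhds.1 (tendsto_exp_smul_mulVec C hA (Pi.single j 1)) i
  have h2 := (Complex.continuous_re.tendsto _).comp h
  refine Tendsto.congr (fun t => ?_) h2
  simp [← hmap]

end Decay

/-! ### The Lyapunov equation and the noise Gramian -/

section Lyapunov

open scoped Matrix.Norms.Operator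
open NormedSpace

variable {n : ℕ} {A N V : Matrix (Fin n) (Fin n) ℝ}

lemma hasDerivAt_exp_mul_mul_exp (A V : Matrix (Fin n) (Fin n) ℝ) (t : ℝ) :
    HasDerivAt (fun u : ℝ => exp (u • A) * V * exp (u • Aᵀ))
      (exp (t • A) * (A * V + V * Aᵀ) * exp (t • Aᵀ)) t := by
  have h := ((hasDerivAt_exp_smul_const A t).mul_const V).mul (hasDerivAt_exp_smul_const' Aᵀ t)
  refine h.congr_deriv ?_
  noncomm_ring

lemma continuous_exp_mul_mul_exp (A V : Matrix (Fin n) (Fin n) ℝ) :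
    Continuous fun t : ℝ => exp (t • A) * V * exp (t • Aᵀ) :=
  continuous_iff_continuousAt.2 fun t => (hasDerivAt_exp_mul_mul_exp A V t).continuousAt

lemma IsHurwitz.tendsto_exp_mul_mul_exp (hA : IsHurwitz A) (V : Matrix (Fin n) (Fin n) ℝ) :
    Tendsto (fun t : ℝ => exp (t • A) * V * exp (t • Aᵀ)) atTop (𝓝 0) := by
  have h2 : Tendsto (fun t : ℝ => exp (t • Aᵀ)) atTop (𝓝 0) := by
    have h := ((continuous_id (X := Matrix (Fin n) (Fin n) ℝ)).matrix_transpose.tendsto 0).comp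
      hA.tendsto_exp
    simp only [id, Matrix.transpose_zero] at h
    refine h.congr fun t => ?_
    simp [← Matrix.exp_transpose]
  simpa using (hA.tendsto_exp.mul_const V).mul h2

/-- A solution of the homogeneous Lyapunov equation is invariant under `V ↦ exp(tA) V exp(tAᵀ)`,
and this flow decays. -/
lemma IsHurwitz.eq_zero_of_lyapunov (hA : IsHurwitz A) (hV : A * V + V * Aᵀ = 0) : V = 0 := by
  have hconst (t : ℝ) : exp (t • A) * V * exp (t • Aᵀ) = V := by
    have h := is_const_of_deriv_eq_zero
      (fun t => (hasDerivAt_exp_mul_mul_exp A V t).differentiableAt)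
      (fun t => by rw [(hasDerivAt_exp_mul_mul_exp A V t).deriv, hV]; simp) t 0
    simpa using h
  refine tendsto_nhds_unique (f := fun _ : ℝ => V) (l := atTop) tendsto_const_nhds ?_
  simpa only [hconst] using hA.tendsto_exp_mul_mul_exp V

/-- The Lyapunov operator is injective, hence bijective by a dimension count. -/
theorem IsHurwitz.exists_lyapunov (hA : IsHurwitz A) (N : Matrix (Fin n) (Fin n) ℝ) :
    ∃ W, ∀ V, A * V + V * Aᵀ + N = 0 ↔ V = W := by
  let L : Matrix (Fin n) (Fin n) ℝ →ₗ[ℝ] Matrix (Fin n) (Fin n) ℝ :=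
    LinearMap.mulLeft ℝ A + LinearMap.mulRight ℝ Aᵀ
  have hL (V) : L V = A * V + V * Aᵀ := rfl
  have hinj : Function.Injective L :=
    (injective_iff_map_eq_zero L).2 fun V hV => hA.eq_zero_of_lyapunov hV
  obtain ⟨W, hW⟩ := LinearMap.surjective_of_injective hinj (-N)
  refine ⟨W, fun V => ?_⟩
  rw [← hL, add_eq_zero_iff_eq_neg, ← hW, hinj.eq_iff]

/-- The Gramian is the amount by which the flow has contracted a solution of the Lyapunov
equation. -/
lemma noiseGramian_eq (hV : A * V + V * Aᵀ + N = 0) (h : ℝ≥0) :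
    noiseGramian A N h = V - exp ((h : ℝ) • A) * V * exp ((h : ℝ) • Aᵀ) := by
  have hN : N = -(A * V + V * Aᵀ) := (neg_eq_of_add_eq_zero_right hV).symm
  ext i j
  have hd (τ : ℝ) : HasDerivAt
      (fun τ : ℝ => (exp (((h : ℝ) - τ) • A) * V * exp (((h : ℝ) - τ) • Aᵀ)) i j)
      ((exp (((h : ℝ) - τ) • A) * N * exp (((h : ℝ) - τ) • Aᵀ)) i j) τ := by
    have h1 := (hasDerivAt_exp_mul_mul_exp A V (h - τ)).comp_const_sub (h : ℝ) τ
    have h2 := hasDerivAt_pi.1 (hasDerivAt_pi.1 h1 i) j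
    refine h2.congr_deriv ?_
    rw [hN, Matrix.mul_neg, Matrix.neg_mul]
  have hc : Continuous fun τ : ℝ =>
      (exp (((h : ℝ) - τ) • A) * N * exp (((h : ℝ) - τ) • Aᵀ)) i j :=
    ((continuous_exp_mul_mul_exp A N).comp (continuous_const.sub continuous_id)).matrix_elem i j
  rw [noiseGramian, Matrix.of_apply,
    intervalIntegral.integral_eq_sub_of_hasDerivAt (fun τ _ => hd τ) (hc.intervalIntegrable _ _)]
  simp

lemma dotProduct_noiseGramian_mulVec (A N : Matrix (Fin n) (Fin n) ℝ) (h : ℝ≥0) (x : Fin n → ℝ) :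
    x ⬝ᵥ noiseGramian A N h *ᵥ x = ∫ τ in (0 : ℝ)..h,
      x ⬝ᵥ (exp (((h : ℝ) - τ) • A) * N * exp (((h : ℝ) - τ) • Aᵀ)) *ᵥ x := by
  have hc (i j : Fin n) : Continuous fun τ : ℝ =>
      (exp (((h : ℝ) - τ) • A) * N * exp (((h : ℝ) - τ) • Aᵀ)) i j :=
    ((continuous_exp_mul_mul_exp A N).comp (continuous_const.sub continuous_id)).matrix_elem i j
  have hsum (M : Matrix (Fin n) (Fin n) ℝ) : x ⬝ᵥ M *ᵥ x = ∑ i, ∑ j, x i * x j * M i j := by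
    simp only [dotProduct, Matrix.mulVec, Finset.mul_sum]
    exact Finset.sum_congr rfl fun i _ => Finset.sum_congr rfl fun j _ => by ring
  have hi (i j : Fin n) : Continuous fun τ : ℝ =>
      x i * x j * (exp (((h : ℝ) - τ) • A) * N * exp (((h : ℝ) - τ) • Aᵀ)) i j :=
    continuous_const.mul (hc i j)
  simp only [hsum]
  rw [intervalIntegral.integral_finsetSum fun i _ =>
    (continuous_finsetSum _ fun j _ => hi i j).intervalIntegrable _ _]
  refine Finset.sum_congr rfl fun i _ => ?_
  rw [intervalIntegral.integral_finsetSum fun j _ => (hi i j).intervalIntegrable _ _]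
  exact Finset.sum_congr rfl fun j _ => (intervalIntegral.integral_const_mul _ _).symm

lemma posSemidef_exp_mul_mul_exp (A : Matrix (Fin n) (Fin n) ℝ) (hV : V.PosSemidef) (t : ℝ) :
    (exp (t • A) * V * exp (t • Aᵀ)).PosSemidef := by
  have h := hV.mul_mul_conjTranspose_same (exp (t • A))
  rwa [Matrix.conjTranspose_eq_transpose_of_trivial, ← Matrix.exp_transpose,
    Matrix.transpose_smul] at h

theorem posSemidef_noiseGramian (A : Matrix (Fin n) (Fin n) ℝ) (hN : N.PosSemidef) (h : ℝ≥0) :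
    (noiseGramian A N h).PosSemidef := by
  have hpos (τ : ℝ) := posSemidef_exp_mul_mul_exp A hN (h - τ)
  refine Matrix.PosSemidef.of_dotProduct_mulVec_nonneg ?_ fun x => ?_
  · ext i j
    simp only [noiseGramian, Matrix.conjTranspose_apply, Matrix.of_apply, star_trivial]
    refine intervalIntegral.integral_congr fun τ _ => ?_
    simpa using (hpos τ).1.apply i j
  · rw [star_trivial, dotProduct_noiseGramian_mulVec]
    exact intervalIntegral.integral_nonneg h.2 fun τ _ => by
      simpa using (hpos τ).dotProduct_mulVec_nonneg x

lemma noiseGramian_sub (hV : A * V + V * Aᵀ + N = 0) {h₁ h₂ : ℝ≥0} (h : h₁ ≤ h₂) :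
    noiseGramian A N h₂ - noiseGramian A N h₁ =
      exp ((h₁ : ℝ) • A) * noiseGramian A N (h₂ - h₁) * exp ((h₁ : ℝ) • Aᵀ) := by
  have hexp (B : Matrix (Fin n) (Fin n) ℝ) :
      exp ((h₂ : ℝ) • B) = exp ((h₁ : ℝ) • B) * exp (((h₂ - h₁ : ℝ≥0) : ℝ) • B) := by
    rw [← Matrix.exp_add_of_commute _ _ (((Commute.refl B).smul_left _).smul_right _), ← add_smul,
      NNReal.coe_sub h]
    congr 2; ring
  have hexp' (B : Matrix (Fin n) (Fin n) ℝ) :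
      exp ((h₂ : ℝ) • B) = exp (((h₂ - h₁ : ℝ≥0) : ℝ) • B) * exp ((h₁ : ℝ) • B) := by
    rw [← Matrix.exp_add_of_commute _ _ (((Commute.refl B).smul_left _).smul_right _), ← add_smul,
      NNReal.coe_sub h]
    congr 2; ring
  rw [noiseGramian_eq hV, noiseGramian_eq hV, noiseGramian_eq hV, hexp A, hexp' Aᵀ]
  noncomm_ring

lemma IsHurwitz.tendsto_noiseGramian (hA : IsHurwitz A) (hV : A * V + V * Aᵀ + N = 0) :
    Tendsto (fun h : ℝ≥0 => noiseGramian A N h) atTop (𝓝 V) := by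
  have h := (tendsto_const_nhds (x := V)).sub
    ((hA.tendsto_exp_mul_mul_exp V).comp (NNReal.tendsto_coe_atTop.2 tendsto_id))
  rw [sub_zero] at h
  exact h.congr fun t => (noiseGramian_eq hV t).symm

theorem IsHurwitz.posSemidef_lyapunov (hA : IsHurwitz A) (hN : N.PosSemidef)
    (hV : A * V + V * Aᵀ + N = 0) : V.PosSemidef := by
  have hlim := hA.tendsto_noiseGramian hV
  have hherm (h : ℝ≥0) := (posSemidef_noiseGramian A hN h).1
  refine Matrix.PosSemidef.of_dotProduct_mulVec_nonneg ?_ fun x => ?_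
  · refine tendsto_nhds_unique (((continuous_id.matrix_conjTranspose).tendsto V).comp hlim) ?_
    exact hlim.congr fun h => (hherm h).symm
  · refine ge_of_tendsto ((Continuous.tendsto (f := fun M : Matrix (Fin n) (Fin n) ℝ =>
      star x ⬝ᵥ M *ᵥ x) (by fun_prop) V).comp hlim) (Eventually.of_forall fun h => ?_)
    exact (posSemidef_noiseGramian A hN h).dotProduct_mulVec_nonneg x

/-- If `V x = 0` then the Lyapunov equation gives `xᵀ N x = 0`. -/
theorem posDef_lyapunov (hN : N.PosDef) (hVpos : V.PosSemidef)
    (hV : A * V + V * Aᵀ + N = 0) : V.PosDef := by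
  refine Matrix.posDef_iff_dotProduct_mulVec.2 ⟨hVpos.1, fun x hx => ?_⟩
  refine (hVpos.dotProduct_mulVec_nonneg x).lt_of_ne' fun h0 => ?_
  have hVx : V *ᵥ x = 0 := (hVpos.dotProduct_mulVec_zero_iff x).1 h0
  have hxV : x ᵥ* V = 0 := by
    rw [← Matrix.mulVec_transpose, ← Matrix.conjTranspose_eq_transpose_of_trivial, hVpos.1.eq, hVx]
  have h1 : x ⬝ᵥ (A * V + V * Aᵀ + N) *ᵥ x = 0 := by rw [hV]; simp
  rw [Matrix.add_mulVec, Matrix.add_mulVec, ← Matrix.mulVec_mulVec, hVx, ← Matrix.mulVec_mulVec,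
    dotProduct_add, dotProduct_add, Matrix.dotProduct_mulVec x V, hxV] at h1
  have h2 := hN.dotProduct_mulVec_pos hx
  simp at h1 h2
  linarith

lemma posSemidef_sub_noiseGramian (hVpos : V.PosSemidef) (hV : A * V + V * Aᵀ + N = 0) (h : ℝ≥0) :
    (V - noiseGramian A N h).PosSemidef := by
  rw [noiseGramian_eq hV, sub_sub_cancel]
  exact posSemidef_exp_mul_mul_exp A hVpos h

end Lyapunov

/-! ### Discretizing a linear integral equation -/

section Path

variable {E : Type*} [NormedAddCommGroup E] [NormedSpace ℝ E] [CompleteSpace E]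

open NormedSpace

lemma continuous_exp_smul (B : E →L[ℝ] E) : Continuous fun r : ℝ => exp (r • B) :=
  continuous_iff_continuousAt.2 fun r => (hasDerivAt_exp_smul_const B r).continuousAt

lemma integral_exp_smul_apply (B : E →L[ℝ] E) (v : E) (δ : ℝ) :
    ∫ r in (0 : ℝ)..δ, B (exp (r • B) v) = exp (δ • B) v - v := by
  have hd (r : ℝ) : HasDerivAt (fun r : ℝ => exp (r • B) v) (B (exp (r • B) v)) r :=
    (ContinuousLinearMap.apply ℝ E v).hasFDerivAt.comp_hasDerivAt r (hasDerivAt_exp_smul_const' B r)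
  have hc : Continuous fun r : ℝ => B (exp (r • B) v) :=
    B.continuous.comp ((continuous_exp_smul B).clm_apply continuous_const)
  rw [intervalIntegral.integral_eq_sub_of_hasDerivAt (fun r _ => hd r) (hc.intervalIntegrable _ _)]
  simp

/-- Over a short step, a solution of `dx = B x ds + dw` moves by the exact flow of `B` plus the
increment of `w`, up to an error that is small compared with the length of the step. -/
lemma norm_step_error_le {B : E →L[ℝ] E} {x w : ℝ → E} (hx : Continuous x) {s δ ε : ℝ}
    (hδ : 0 ≤ δ) (heq : x (s + δ) - x s = (∫ r in s..s + δ, B (x r)) + (w (s + δ) - w s))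
    (hF : ∀ r ∈ Set.Icc 0 δ, ‖x (s + r) - exp (r • B) (x s)‖ ≤ ε) :
    ‖x (s + δ) - exp (δ • B) (x s) - (w (s + δ) - w s)‖ ≤ ‖B‖ * ε * δ := by
  have hc : Continuous fun r : ℝ => B (exp (r • B) (x s)) :=
    B.continuous.comp ((continuous_exp_smul B).clm_apply continuous_const)
  have hc' : Continuous fun r : ℝ => B (x (s + r)) := by fun_prop
  have hshift : ∫ r in s..s + δ, B (x r) = ∫ r in (0 : ℝ)..δ, B (x (s + r)) := by
    rw [intervalIntegral.integral_comp_add_left (fun r => B (x r)) s, add_zero]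
  have hmain : x (s + δ) - exp (δ • B) (x s) - (w (s + δ) - w s) =
      ∫ r in (0 : ℝ)..δ, B (x (s + r) - exp (r • B) (x s)) := by
    simp_rw [map_sub]
    rw [intervalIntegral.integral_sub (hc'.intervalIntegrable _ _) (hc.intervalIntegrable _ _),
      integral_exp_smul_apply, ← hshift, ← sub_eq_iff_eq_add.2 heq]
    abel
  rw [hmain]
  refine (intervalIntegral.norm_integral_le_of_norm_le_const (C := ‖B‖ * ε)
    fun r hr => ?_).trans_eq (by rw [sub_zero, abs_of_nonneg hδ])
  rw [Set.uIoc_of_le hδ] at hr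
  exact (B.le_opNorm _).trans (mul_le_mul_of_nonneg_left (hF r ⟨hr.1.le, hr.2⟩) (norm_nonneg _))

/-- The noise accumulated by a solution of `dx = B x ds + dw` over `[a, a + h]` is a limit of
weighted sums of increments of `w`. -/
theorem tendsto_sum_exp_increment {B : E →L[ℝ] E} {x w : ℝ → E} (hx : Continuous x) {a h : ℝ}
    (hh : 0 ≤ h) (heq : ∀ s u, a ≤ s → s ≤ u →
      x u - x s = (∫ r in s..u, B (x r)) + (w u - w s)) :
    Tendsto (fun m : ℕ => ∑ k ∈ Finset.range m, exp ((h - (k + 1) * (h / m)) • B)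
      (w (a + (k + 1) * (h / m)) - w (a + k * (h / m)))) atTop
      (𝓝 (x (a + h) - exp (h • B) (x a))) := by
  let _ : NormedAlgebra ℚ (E →L[ℝ] E) := NormedAlgebra.restrictScalars ℚ ℝ (E →L[ℝ] E)
  obtain ⟨K, hK⟩ := (isCompact_Icc (a := (0 : ℝ)) (b := h)).exists_bound_of_continuousOn
    (continuous_exp_smul B).continuousOn
  have hK0 : 0 ≤ K := (norm_nonneg _).trans (hK 0 ⟨le_rfl, hh⟩)
  rw [Metric.tendsto_atTop]
  intro ε hε
  obtain ⟨ε', hε', hlt⟩ : ∃ ε' > 0, K * (‖B‖ * ε') * h < ε := by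
    refine ⟨ε / (K * ‖B‖ * h + 1), by positivity, ?_⟩
    rw [show K * (‖B‖ * (ε / (K * ‖B‖ * h + 1))) * h =
      ε * ((K * ‖B‖ * h) / (K * ‖B‖ * h + 1)) by ring]
    have : (K * ‖B‖ * h) / (K * ‖B‖ * h + 1) < 1 := by
      rw [div_lt_one (by positivity)]; linarith
    nlinarith
  -- the defect of the flow is uniformly small over short steps
  have hFc : Continuous fun p : ℝ × ℝ => x (p.1 + p.2) - exp (p.2 • B) (x p.1) :=
    (hx.comp (continuous_fst.add continuous_snd)).sub
      (((continuous_exp_smul B).comp continuous_snd).clm_apply (hx.comp continuous_fst))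
  have hsmall : ∀ᶠ r in 𝓝 (0 : ℝ), ∀ s ∈ Set.Icc a (a + h),
      ‖x (s + r) - exp (r • B) (x s)‖ < ε' := by
    refine isCompact_Icc.eventually_forall_of_forall_eventually fun s _ => ?_
    have h1 : Continuous fun p : ℝ × ℝ => ‖x (p.2 + p.1) - exp (p.1 • B) (x p.2)‖ :=
      (hFc.comp continuous_swap).norm
    exact (h1.tendsto (0, s)).eventually_lt_const (by simpa using hε')
  obtain ⟨δ₀, hδ₀, hball⟩ := Metric.eventually_nhds_iff.1 hsmall
  obtain ⟨m₀, hm₀⟩ := exists_nat_gt (h / δ₀)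
  refine ⟨m₀ + 1, fun m hm => ?_⟩
  have hmpos : (0 : ℝ) < m := by exact_mod_cast (Nat.succ_pos m₀).trans_le hm
  set δ : ℝ := h / m with hδ
  have hδ0 : 0 ≤ δ := by positivity
  have hmδ : m * δ = h := by rw [hδ]; field_simp
  have hδlt : δ < δ₀ := by
    have : (m₀ : ℝ) < m := by exact_mod_cast hm
    rw [hδ, div_lt_iff₀ hmpos, mul_comm, ← div_lt_iff₀ hδ₀]; linarith
  have hle (k : ℕ) (hk : k ∈ Finset.range m) : ((k : ℝ) + 1) * δ ≤ h := by
    rw [← hmδ]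
    have : ((k : ℝ) + 1) ≤ m := by exact_mod_cast Finset.mem_range.1 hk
    gcongr
  -- each summand compares the solution with the flow over one step of length `δ`
  have htel : x (a + h) - exp (h • B) (x a) = ∑ k ∈ Finset.range m,
      exp ((h - (k + 1) * δ) • B) (x (a + (k + 1) * δ) - exp (δ • B) (x (a + k * δ))) := by
    have h1 := Finset.sum_range_sub
      (fun k : ℕ => exp ((h - k * δ) • B) (x (a + k * δ))) m
    simp only [hmδ, sub_self, zero_smul, exp_zero, Nat.cast_zero, zero_mul, sub_zero,
      add_zero, one_apply_eq_self] at h1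
    rw [← h1]
    refine Finset.sum_congr rfl fun k _ => ?_
    push_cast
    rw [map_sub, ← mul_apply_eq_comp,
      ← exp_add_of_commute (((Commute.refl B).smul_left _).smul_right _), ← add_smul]
    congr 4; ring
  rw [dist_eq_norm, htel, ← Finset.sum_sub_distrib]
  refine lt_of_le_of_lt ?_ hlt
  calc _ ≤ ∑ k ∈ Finset.range m, K * (‖B‖ * ε' * δ) := by
        refine norm_sum_le_of_le _ fun k hk => ?_
        have hk0 : 0 ≤ (k : ℝ) * δ := by positivity
        have hs : a + k * δ ∈ Set.Icc a (a + h) := by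
          constructor
          · linarith
          · linarith [hle k hk]
        have hstep : a + (k + 1) * δ = a + k * δ + δ := by ring
        rw [← map_sub, ← norm_neg, ← map_neg, neg_sub, hstep]
        refine (ContinuousLinearMap.le_opNorm _ _).trans
          (mul_le_mul (hK _ ⟨by linarith [hle k hk], by linarith⟩)
            (norm_step_error_le hx hδ0 (heq _ _ (by linarith) (by linarith)) fun r hr => ?_)
            (norm_nonneg _) hK0)
        refine (hball ?_ _ hs).le
        rw [Real.dist_eq, sub_zero, abs_of_nonneg hr.1]
        exact hr.2.trans_lt hδlt
    _ = K * (‖B‖ * ε') * h := by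
        rw [Finset.sum_const, Finset.card_range, nsmul_eq_mul, ← hmδ]; ring

/-- Right-endpoint Riemann sums. -/
lemma tendsto_riemannSum {q : ℝ → ℝ} (hq : Continuous q) {h : ℝ} (hh : 0 ≤ h) :
    Tendsto (fun m : ℕ => ∑ k ∈ Finset.range m, (h / m) * q ((k + 1) * (h / m))) atTop
      (𝓝 (∫ τ in (0 : ℝ)..h, q τ)) := by
  rw [Metric.tendsto_atTop]
  intro ε hε
  obtain ⟨ε', hε', hlt⟩ : ∃ ε' > 0, ε' * h < ε := by
    refine ⟨ε / (h + 1), by positivity, ?_⟩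
    rw [div_mul_eq_mul_div, div_lt_iff₀ (by positivity)]; nlinarith
  have huc := isCompact_Icc.uniformContinuousOn_of_continuous (s := Set.Icc 0 h) hq.continuousOn
  obtain ⟨δ₀, hδ₀, hball⟩ := Metric.uniformContinuousOn_iff.1 huc ε' hε'
  obtain ⟨m₀, hm₀⟩ := exists_nat_gt (h / δ₀)
  refine ⟨m₀ + 1, fun m hm => ?_⟩
  have hmpos : (0 : ℝ) < m := by exact_mod_cast (Nat.succ_pos m₀).trans_le hm
  set δ : ℝ := h / m with hδ
  have hδ0 : 0 ≤ δ := by positivity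
  have hmδ : m * δ = h := by rw [hδ]; field_simp
  have hδlt : δ < δ₀ := by
    have : (m₀ : ℝ) < m := by exact_mod_cast hm
    rw [hδ, div_lt_iff₀ hmpos, mul_comm, ← div_lt_iff₀ hδ₀]; linarith
  have hle (k : ℕ) (hk : k ∈ Finset.range m) : ((k : ℝ) + 1) * δ ≤ h := by
    rw [← hmδ]
    have : ((k : ℝ) + 1) ≤ m := by exact_mod_cast Finset.mem_range.1 hk
    gcongr
  have hsum := intervalIntegral.sum_integral_adjacent_intervals (μ := volume) (f := q)
    (a := fun k : ℕ => (k : ℝ) * δ) (n := m) fun k _ => hq.intervalIntegrable _ _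
  simp only [Nat.cast_zero, zero_mul, hmδ] at hsum
  rw [dist_eq_norm, ← hsum, ← Finset.sum_sub_distrib]
  refine lt_of_le_of_lt ?_ hlt
  calc _ ≤ ∑ k ∈ Finset.range m, ε' * δ := by
        refine norm_sum_le_of_le _ fun k hk => ?_
        have hkk : (k : ℝ) * δ ≤ (k + 1) * δ := by nlinarith
        have hconst : δ * q ((k + 1) * δ) =
            ∫ _ in (k : ℝ) * δ..((k + 1 : ℕ) : ℝ) * δ, q ((k + 1) * δ) := by
          rw [intervalIntegral.integral_const, smul_eq_mul]; push_cast; ring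
        rw [hconst, ← intervalIntegral.integral_sub (by simp) (hq.intervalIntegrable _ _)]
        push_cast
        refine (intervalIntegral.norm_integral_le_of_norm_le_const (C := ε')
          fun r hr => ?_).trans_eq ?_
        · rw [Set.uIoc_of_le hkk] at hr
          have hk0 : 0 ≤ (k : ℝ) * δ := by positivity
          rw [← dist_eq_norm]
          refine (hball _ ⟨hk0.trans hkk, hle k hk⟩ _
            ⟨hk0.trans hr.1.le, hr.2.trans (hle k hk)⟩ ?_).le
          rw [Real.dist_eq, abs_of_nonneg (by linarith [hr.2])]
          nlinarith [hr.1]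
        · rw [abs_of_nonneg (by linarith)]; ring
    _ = ε' * h := by
        rw [Finset.sum_const, Finset.card_range, nsmul_eq_mul, ← hmδ]; ring

end Path

/-! ### The conditional law of the change of state -/

section Increments

variable {n : ℕ} {Ω : Type*} {m : MeasurableSpace Ω} {P : Measure Ω}
  {N : Matrix (Fin n) (Fin n) ℝ} {ℱ : Filtration ℝ≥0 m}
  {w : ℝ≥0 → Ω → EuclideanSpace ℝ (Fin n)}

lemma IsBrownianMotion.measurable (hw : IsBrownianMotion N ℱ P w) (t : ℝ≥0) : Measurable (w t) :=
  (hw.adapted t).mono (ℱ.le t) le_rfl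

lemma IsBrownianMotion.integral_cexp_increment (hw : IsBrownianMotion N ℱ P w)
    (hN : N.PosSemidef) {s t : ℝ≥0} (hst : s ≤ t) (v : EuclideanSpace ℝ (Fin n)) :
    ∫ ω, Complex.exp (inner ℝ (w t ω - w s ω) v * Complex.I) ∂P =
      Complex.exp (-(((t : ℝ) - s) * (v ⬝ᵥ N *ᵥ v) / 2 : ℝ)) := by
  have hts : (0 : ℝ) ≤ t - s := sub_nonneg.2 (NNReal.coe_le_coe.2 hst)
  have h := charFun_apply (μ := P.map fun ω => w t ω - w s ω) v
  have hm : Measurable fun ω => w t ω - w s ω := (hw.measurable t).sub (hw.measurable s)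
  rw [integral_map hm.aemeasurable (by fun_prop)] at h
  rw [← h, hw.law_increment s t hst, charFun_multivariateGaussian (hN.smul hts)]
  congr 1
  simp [Matrix.smul_mulVec]

/-- The increments after time `s 0` are independent of each other and of the past. -/
lemma IsBrownianMotion.integral_mul_cexp_sum_increment [IsProbabilityMeasure P]
    (hw : IsBrownianMotion N ℱ P w) (hN : N.PosSemidef) {s : ℕ → ℝ≥0} (hs : Monotone s)
    (v : ℕ → EuclideanSpace ℝ (Fin n)) {g : Ω → ℂ} (hg : Measurable[ℱ (s 0)] g) (k : ℕ) :
    ∫ ω, g ω * Complex.exp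
        ((∑ j ∈ Finset.range k, inner ℝ (w (s (j + 1)) ω - w (s j) ω) (v j) : ℝ) * Complex.I) ∂P =
      (∫ ω, g ω ∂P) * Complex.exp
        (-(∑ j ∈ Finset.range k, ((s (j + 1) : ℝ) - s j) * (v j ⬝ᵥ N *ᵥ v j) / 2 : ℝ)) := by
  induction k with
  | zero => simp
  | succ k ih =>
    set G : Ω → ℂ := fun ω => g ω * Complex.exp
      ((∑ j ∈ Finset.range k, inner ℝ (w (s (j + 1)) ω - w (s j) ω) (v j) : ℝ) * Complex.I) with hG
    have hwm (j : ℕ) (hj : j ≤ k) : Measurable[ℱ (s k)] (w (s j)) :=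
      (hw.adapted (s j)).mono (ℱ.mono (hs hj)) le_rfl
    have hGm : Measurable[ℱ (s k)] G := by
      refine (hg.mono (ℱ.mono (hs (Nat.zero_le k))) le_rfl).mul ?_
      refine Complex.measurable_exp.comp ((Complex.measurable_ofReal.comp ?_).mul_const _)
      refine Finset.measurable_sum _ fun j hj => ?_
      have hj' := Finset.mem_range.1 hj
      exact ((hwm (j + 1) hj').sub (hwm j hj'.le)).inner_const
    set e : EuclideanSpace ℝ (Fin n) → ℂ := fun x => Complex.exp (inner ℝ x (v k) * Complex.I)
    have he : Measurable e := by fun_prop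
    have hind : G ⟂ᵢ[P] (fun ω => e (w (s (k + 1)) ω - w (s k) ω)) := by
      have h := hw.indep_increment (s k) (s (k + 1)) (hs k.le_succ)
      refine (IndepFun_iff_Indep _ _ _).2 (indep_of_indep_of_le_left
        (indep_of_indep_of_le_right h.symm ?_) hGm.comap_le)
      rw [show (fun ω => e (w (s (k + 1)) ω - w (s k) ω)) =
        e ∘ fun ω => w (s (k + 1)) ω - w (s k) ω from rfl, ← MeasurableSpace.comap_comp]
      exact MeasurableSpace.comap_mono he.comap_le
    have hfac := hind.integral_fun_mul_eq_mul_integral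
      (hGm.mono (ℱ.le _) le_rfl).aestronglyMeasurable
      (he.comp ((hw.measurable _).sub (hw.measurable _))).aestronglyMeasurable
    rw [ih, hw.integral_cexp_increment hN (hs k.le_succ)] at hfac
    rw [Finset.sum_range_succ, Complex.ofReal_add, neg_add, Complex.exp_add, ← mul_assoc, ← hfac]
    refine integral_congr_ae (Eventually.of_forall fun ω => ?_)
    simp only [G, e]
    rw [Finset.sum_range_succ, Complex.ofReal_add, add_mul, Complex.exp_add, mul_assoc]

end Increments

section Euclidean

open NormedSpace
open scoped Matrix.Norms.Operator

variable {n : ℕ}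

lemma toEuclideanCLM_exp_smul (A : Matrix (Fin n) (Fin n) ℝ) (r : ℝ) :
    Matrix.toEuclideanCLM (𝕜 := ℝ) (exp (r • A)) = exp (r • Matrix.toEuclideanCLM (𝕜 := ℝ) A) := by
  have hc : Continuous (Matrix.toEuclideanCLM (𝕜 := ℝ) (n := Fin n)) :=
    LinearMap.continuous_of_finiteDimensional
      (Matrix.toEuclideanCLM (𝕜 := ℝ) (n := Fin n)).toAlgEquiv.toLinearMap
  exact (map_exp (Matrix.toEuclideanCLM (𝕜 := ℝ) (n := Fin n)) hc _).trans (by rw [map_smul])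

lemma inner_toEuclideanCLM_left (M : Matrix (Fin n) (Fin n) ℝ) (x y : EuclideanSpace ℝ (Fin n)) :
    inner ℝ (Matrix.toEuclideanCLM (𝕜 := ℝ) M x) y =
      inner ℝ x (Matrix.toEuclideanCLM (𝕜 := ℝ) Mᵀ y) := by
  rw [real_inner_comm, Matrix.inner_toEuclideanCLM, Matrix.inner_toEuclideanCLM,
    Matrix.dotProduct_mulVec, Matrix.mulVec_transpose, dotProduct_comm]

lemma dotProduct_toEuclideanCLM (M N : Matrix (Fin n) (Fin n) ℝ) (x : EuclideanSpace ℝ (Fin n)) :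
    (Matrix.toEuclideanCLM (𝕜 := ℝ) Mᵀ x) ⬝ᵥ N *ᵥ (Matrix.toEuclideanCLM (𝕜 := ℝ) Mᵀ x) =
      x ⬝ᵥ (M * N * Mᵀ) *ᵥ x := by
  rw [Matrix.ofLp_toEuclideanCLM, Matrix.mulVec_transpose, ← Matrix.dotProduct_mulVec,
    Matrix.mulVec_mulVec, ← Matrix.mulVec_transpose, Matrix.mulVec_mulVec]

/-- A Gaussian law is a translate of the centred one. -/
lemma multivariateGaussian_map_add (μ : EuclideanSpace ℝ (Fin n)) (S : Matrix (Fin n) (Fin n) ℝ) :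
    (multivariateGaussian 0 S).map (fun z => μ + z) = multivariateGaussian μ S := by
  rw [multivariateGaussian, multivariateGaussian, Measure.map_map (by fun_prop) (by fun_prop)]
  congr 1
  ext1 x
  simp

end Euclidean

section Solution

open NormedSpace

variable {n : ℕ} {Ω : Type*} {m : MeasurableSpace Ω} {P : Measure Ω}
  {A N : Matrix (Fin n) (Fin n) ℝ} {ℱ : Filtration ℝ≥0 m}
  {w X : ℝ≥0 → Ω → EuclideanSpace ℝ (Fin n)}

/-- The noise accumulated over `[t, t + h]`: what the state at time `t + h` adds to the image of
the state at time `t` under the flow. -/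
noncomputable def accumulatedNoise (A : Matrix (Fin n) (Fin n) ℝ)
    (X : ℝ≥0 → Ω → EuclideanSpace ℝ (Fin n)) (t h : ℝ≥0) (ω : Ω) : EuclideanSpace ℝ (Fin n) :=
  X (t + h) ω - Matrix.toEuclideanCLM (𝕜 := ℝ) (exp ((h : ℝ) • A)) (X t ω)

lemma IsSolution.measurable (hX : IsSolution A ℱ P w X) (t : ℝ≥0) : Measurable (X t) :=
  (hX.adapted t).mono (ℱ.le t) le_rfl

lemma IsSolution.measurable_accumulatedNoise (hX : IsSolution A ℱ P w X) (t h : ℝ≥0) :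
    Measurable (accumulatedNoise A X t h) := by
  have h1 := hX.measurable (t + h)
  have h2 := hX.measurable t
  unfold accumulatedNoise
  fun_prop

lemma IsSolution.tendsto_sum_increment (hX : IsSolution A ℱ P w X) (t h : ℝ≥0) :
    ∀ᵐ ω ∂P, Tendsto (fun k : ℕ => ∑ j ∈ Finset.range k,
      Matrix.toEuclideanCLM (𝕜 := ℝ) (exp (((h : ℝ) - (j + 1) * (h / k)) • A))
        (w (t + ((j + 1 : ℕ) : ℝ≥0) * (h / k)) ω - w (t + (j : ℝ≥0) * (h / k)) ω)) atTop
      (𝓝 (accumulatedNoise A X t h ω)) := by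
  filter_upwards [hX.continuous, hX.eqn] with ω hc heq
  set B := Matrix.toEuclideanCLM (𝕜 := ℝ) A
  have hx : Continuous fun s : ℝ => X s.toNNReal ω := hc.comp continuous_real_toNNReal
  have key := tendsto_sum_exp_increment (B := B) (w := fun s => w s.toNNReal ω) hx
    (a := t) h.coe_nonneg fun s u hs hsu => by
      have hBx : Continuous fun s : ℝ => B (X s.toNNReal ω) := B.continuous.comp hx
      have hs0 : 0 ≤ s := t.2.trans hs
      have e1 := heq s.toNNReal
      have e2 := heq u.toNNReal
      rw [Real.coe_toNNReal _ hs0] at e1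
      rw [Real.coe_toNNReal _ (hs0.trans hsu)] at e2
      rw [← intervalIntegral.integral_interval_sub_left (hBx.intervalIntegrable 0 u)
        (hBx.intervalIntegrable 0 s), e1, e2]
      abel
  have hcoe (c : ℝ≥0) (k : ℕ) :
      ((t : ℝ) + c * ((h : ℝ) / k)).toNNReal = t + c * (h / k) := by
    rw [← Real.toNNReal_coe (r := t + c * (h / k))]
    push_cast; rfl
  convert! key using 2
  · refine Finset.sum_congr rfl fun j _ => ?_
    rw [toEuclideanCLM_exp_smul]
    have h1 := hcoe ((j + 1 : ℕ) : ℝ≥0)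
    have h2 := hcoe (j : ℝ≥0)
    push_cast at h1 h2 ⊢
    simp only [h1, h2]
    rfl
  · rw [accumulatedNoise, toEuclideanCLM_exp_smul, ← NNReal.coe_add, Real.toNNReal_coe,
      Real.toNNReal_coe]

/-- The accumulated noise is centred Gaussian with the Gramian as covariance, and independent of
the past, here in the form of a characteristic function tested against a variable `g` of the
past. -/
lemma IsSolution.integral_mul_cexp_accumulatedNoise [IsProbabilityMeasure P]
    (hw : IsBrownianMotion N ℱ P w) (hX : IsSolution A ℱ P w X) (hN : N.PosSemidef) (t h : ℝ≥0)
    {g : Ω → ℂ} (hg : Measurable[ℱ t] g) (hg1 : ∀ ω, ‖g ω‖ ≤ 1) (ξ : EuclideanSpace ℝ (Fin n)) :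
    ∫ ω, g ω * Complex.exp (inner ℝ (accumulatedNoise A X t h ω) ξ * Complex.I) ∂P =
      (∫ ω, g ω ∂P) * charFun (multivariateGaussian 0 (noiseGramian A N h)) ξ := by
  let s (k j : ℕ) : ℝ≥0 := t + (j : ℝ≥0) * (h / k)
  let v (k j : ℕ) : EuclideanSpace ℝ (Fin n) :=
    Matrix.toEuclideanCLM (𝕜 := ℝ) (exp (((h : ℝ) - (j + 1) * (h / k)) • A))ᵀ ξ
  have hs (k : ℕ) : Monotone (s k) := fun i j hij => by
    simp only [s]; gcongr
  have hs0 (k : ℕ) : s k 0 = t := by simp [s]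
  have hfin (k : ℕ) := hw.integral_mul_cexp_sum_increment hN (hs k) (v k) (g := g)
    (by rw [hs0]; exact hg) k
  have hgm : Measurable g := hg.mono (ℱ.le t) le_rfl
  have hwm := hw.measurable
  -- the left-hand sides converge by dominated convergence
  have hleft : Tendsto (fun k : ℕ => ∫ ω, g ω * Complex.exp
      ((∑ j ∈ Finset.range k, inner ℝ (w (s k (j + 1)) ω - w (s k j) ω) (v k j) : ℝ) * Complex.I)
        ∂P) atTop
      (𝓝 (∫ ω, g ω * Complex.exp (inner ℝ (accumulatedNoise A X t h ω) ξ * Complex.I) ∂P)) := by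
    refine tendsto_integral_of_dominated_convergence (fun _ => 1) (fun k => ?_)
      (integrable_const _) (fun k => Eventually.of_forall fun ω => ?_) ?_
    · have : Measurable fun ω => ∑ j ∈ Finset.range k,
          inner ℝ (w (s k (j + 1)) ω - w (s k j) ω) (v k j) :=
        Finset.measurable_sum _ fun j _ => ((hwm _).sub (hwm _)).inner_const
      exact (hgm.mul (Complex.measurable_exp.comp
        ((Complex.measurable_ofReal.comp this).mul_const _))).aestronglyMeasurable
    · rw [norm_mul, Complex.norm_exp_ofReal_mul_I, mul_one]; exact hg1 ω
    · filter_upwards [hX.tendsto_sum_increment t h] with ω hω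
      refine tendsto_const_nhds.mul ((Complex.continuous_exp.tendsto _).comp
        (((Complex.continuous_ofReal.tendsto _).comp ?_).mul_const _))
      have h1 := Filter.Tendsto.inner (𝕜 := ℝ) hω (tendsto_const_nhds (x := ξ))
      refine h1.congr fun k => ?_
      rw [sum_inner]
      refine Finset.sum_congr rfl fun j _ => ?_
      rw [inner_toEuclideanCLM_left]
  -- the exponents on the right-hand sides are Riemann sums
  have hq : Continuous fun τ : ℝ =>
      ξ ⬝ᵥ (exp (((h : ℝ) - τ) • A) * N * exp (((h : ℝ) - τ) • Aᵀ)) *ᵥ ξ :=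
    (Continuous.dotProduct continuous_const (Continuous.matrix_mulVec
      ((continuous_exp_mul_mul_exp A N).comp (continuous_const.sub continuous_id))
      continuous_const))
  have hR := tendsto_riemannSum hq h.coe_nonneg
  rw [← dotProduct_noiseGramian_mulVec] at hR
  have hright : Tendsto (fun k : ℕ => (∫ ω, g ω ∂P) * Complex.exp
      (-(∑ j ∈ Finset.range k, ((s k (j + 1) : ℝ) - s k j) * (v k j ⬝ᵥ N *ᵥ v k j) / 2 : ℝ))) atTop
      (𝓝 ((∫ ω, g ω ∂P) * charFun (multivariateGaussian 0 (noiseGramian A N h)) ξ)) := by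
    rw [charFun_multivariateGaussian (posSemidef_noiseGramian A hN h)]
    have h2 := ((Complex.continuous_ofReal.tendsto _).comp (hR.div_const 2)).neg
    have h3 := ((Complex.continuous_exp.tendsto _).comp h2).const_mul (∫ ω, g ω ∂P)
    convert! h3 using 2
    · simp only [Function.comp]
      congr 4
      rw [Finset.sum_div]
      refine Finset.sum_congr rfl fun j _ => ?_
      rw [dotProduct_toEuclideanCLM, ← Matrix.exp_transpose, Matrix.transpose_smul]
      simp only [s]
      push_cast
      congr 2; ring
    · simp
  refine tendsto_nhds_unique hleft (hright.congr fun k => (hfin k).symm)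

lemma IsSolution.map_accumulatedNoise [IsProbabilityMeasure P]
    (hw : IsBrownianMotion N ℱ P w) (hX : IsSolution A ℱ P w X) (hN : N.PosSemidef) (t h : ℝ≥0) :
    P.map (accumulatedNoise A X t h) = multivariateGaussian 0 (noiseGramian A N h) := by
  have hm := hX.measurable_accumulatedNoise t h
  have : IsProbabilityMeasure (P.map (accumulatedNoise A X t h)) :=
    Measure.isProbabilityMeasure_map hm.aemeasurable
  refine Measure.ext_of_charFun (funext fun ξ => ?_)
  have h1 := hX.integral_mul_cexp_accumulatedNoise hw hN t h (g := fun _ => 1)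
    measurable_const (fun _ => by simp) ξ
  simp only [one_mul, integral_const, probReal_univ, one_smul] at h1
  rw [charFun_apply, integral_map hm.aemeasurable (by fun_prop), h1]

lemma IsSolution.indepFun_accumulatedNoise [IsProbabilityMeasure P]
    (hw : IsBrownianMotion N ℱ P w) (hX : IsSolution A ℱ P w X) (hN : N.PosSemidef) (t h : ℝ≥0) :
    X t ⟂ᵢ[P] accumulatedNoise A X t h := by
  have hm := hX.measurable_accumulatedNoise t h
  have hXm := hX.measurable t
  rw [indepFun_iff_charFun_prod hXm.aemeasurable hm.aemeasurable]
  intro p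
  have h1 := hX.integral_mul_cexp_accumulatedNoise hw hN t h
    (g := fun ω => Complex.exp (inner ℝ (X t ω) p.ofLp.1 * Complex.I))
    (Complex.measurable_exp.comp ((Complex.measurable_ofReal.comp
      (hX.adapted t).inner_const).mul_const _))
    (fun ω => by rw [Complex.norm_exp_ofReal_mul_I]) p.ofLp.2
  rw [hX.map_accumulatedNoise hw hN, charFun_apply, charFun_apply (μ := P.map (X t)),
    integral_map (by fun_prop) (by fun_prop), integral_map (by fun_prop) (by fun_prop), ← h1]
  refine integral_congr_ae (Eventually.of_forall fun ω => ?_)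
  simp only [WithLp.prod_inner_apply, Complex.ofReal_add, add_mul, Complex.exp_add]

/-- The kernel `x ↦ N((exp(hA) - I) x, W(h))`. -/
noncomputable def incrementKernel (A N : Matrix (Fin n) (Fin n) ℝ) (h : ℝ≥0) :
    Kernel (EuclideanSpace ℝ (Fin n)) (EuclideanSpace ℝ (Fin n)) :=
  (Kernel.id ×ₖ Kernel.const _ (multivariateGaussian 0 (noiseGramian A N h))).map
    fun p => meanIncrement A h p.1 + p.2

lemma measurable_meanIncrement (A : Matrix (Fin n) (Fin n) ℝ) (h : ℝ≥0) :
    Measurable (meanIncrement A h) :=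
  (Matrix.toEuclideanCLM (𝕜 := ℝ) (exp ((h : ℝ) • A) - 1)).measurable

lemma incrementKernel_apply (A N : Matrix (Fin n) (Fin n) ℝ) (h : ℝ≥0)
    (x : EuclideanSpace ℝ (Fin n)) : incrementKernel A N h x = incrementLaw A N h x := by
  have hm := measurable_meanIncrement A h
  rw [incrementLaw, ← multivariateGaussian_map_add]
  refine Measure.ext_of_lintegral _ fun f hf => ?_
  rw [incrementKernel, Kernel.lintegral_map _ (by fun_prop) _ hf,
    Kernel.lintegral_id_prod (by fun_prop), Kernel.const_apply, lintegral_map hf (by fun_prop)]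

theorem IsSolution.changeOfState_ae_eq [IsProbabilityMeasure P]
    (hw : IsBrownianMotion N ℱ P w) (hX : IsSolution A ℱ P w X) (hN : N.PosSemidef) (t h : ℝ≥0) :
    ∀ᵐ x ∂(P.map (X t)), changeOfState P X t h x = incrementLaw A N h x := by
  have hm := hX.measurable_accumulatedNoise t h
  have hXm := hX.measurable t
  have hXm' := hX.measurable (t + h)
  have hmean := measurable_meanIncrement A h
  have hker : IsMarkovKernel (incrementKernel A N h) := Kernel.IsMarkovKernel.map _ (by fun_prop)
  have hsplit (ω : Ω) : X (t + h) ω - X t ω =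
      meanIncrement A h (X t ω) + accumulatedNoise A X t h ω := by
    simp [meanIncrement, accumulatedNoise, map_sub]
  have hjoint := (indepFun_iff_map_prod_eq_prod_map_map hXm.aemeasurable hm.aemeasurable).1
    (hX.indepFun_accumulatedNoise hw hN t h)
  rw [hX.map_accumulatedNoise hw hN] at hjoint
  have h1 := condDistrib_ae_eq_of_measure_eq_compProd (μ := P) (X t)
    (Y := fun ω => X (t + h) ω - X t ω) (by fun_prop) (κ := incrementKernel A N h) (by
      have : (fun ω => (X t ω, X (t + h) ω - X t ω)) =
          (fun p => (p.1, meanIncrement A h p.1 + p.2)) ∘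
            fun ω => (X t ω, accumulatedNoise A X t h ω) := by
        ext1 ω; simp [hsplit ω]
      rw [this, ← Measure.map_map (by fun_prop) (by fun_prop), hjoint]
      refine Measure.ext_of_lintegral _ fun f hf => ?_
      rw [lintegral_map hf (by fun_prop), lintegral_prod _ (by fun_prop),
        Measure.lintegral_compProd hf]
      refine lintegral_congr fun x => ?_
      rw [incrementKernel, Kernel.lintegral_map _ (by fun_prop) _ (by fun_prop),
        Kernel.lintegral_id_prod (by fun_prop), Kernel.const_apply])
  filter_upwards [h1] with x hx
  rw [← incrementKernel_apply, ← hx]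
  rfl

end Solution

/-! ### Rates of Gaussian sources -/

section Gaussian

variable {n : ℕ} {S S₁ S₂ : Matrix (Fin n) (Fin n) ℝ}

lemma multivariateGaussian_conv (μ₁ μ₂ : EuclideanSpace ℝ (Fin n)) (h₁ : S₁.PosSemidef)
    (h₂ : S₂.PosSemidef) :
    multivariateGaussian μ₁ S₁ ∗ multivariateGaussian μ₂ S₂ =
      multivariateGaussian (μ₁ + μ₂) (S₁ + S₂) := by
  refine Measure.ext_of_charFun (funext fun x => ?_)
  rw [charFun_conv, charFun_multivariateGaussian h₁, charFun_multivariateGaussian h₂,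
    charFun_multivariateGaussian (h₁.add h₂), ← Complex.exp_add, inner_add_right,
    Matrix.add_mulVec, dotProduct_add]
  congr 1
  push_cast
  ring

/-- The rate of a Gaussian source is monotone in the covariance and does not depend on the
mean: the source with the larger covariance is the other one plus independent noise. -/
theorem rateDistortion_multivariateGaussian_mono (μ₁ μ₂ : EuclideanSpace ℝ (Fin n))
    (h₁ : S₁.PosSemidef) (h : (S₂ - S₁).PosSemidef) (D : ℝ≥0) :
    rateDistortion (multivariateGaussian μ₁ S₁) D ≤
      rateDistortion (multivariateGaussian μ₂ S₂) D := by
  have hconv := multivariateGaussian_conv μ₁ (μ₂ - μ₁) h₁ h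
  rw [add_sub_cancel, add_sub_cancel] at hconv
  rw [← hconv]
  exact rateDistortion_le_conv _ _ D

lemma lintegral_enorm_sq_multivariateGaussian (hS : S.PosSemidef) :
    ∫⁻ z, ‖z‖ₑ ^ 2 ∂(multivariateGaussian 0 S) = ENNReal.ofReal S.trace := by
  have hL2 : MemLp id 2 (multivariateGaussian (0 : EuclideanSpace ℝ (Fin n)) S) :=
    IsGaussian.memLp_two_id
  have hsq (x : EuclideanSpace ℝ (Fin n)) : ‖x‖ₑ ^ 2 = ENNReal.ofReal (‖x‖ ^ 2) := by
    rw [← ofReal_norm, ENNReal.ofReal_pow (norm_nonneg x)]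
  have hint : Integrable (fun z : EuclideanSpace ℝ (Fin n) => ‖z‖ ^ 2)
      (multivariateGaussian 0 S) := hL2.integrable_norm_pow (by norm_num)
  have hcoord (i : Fin n) : MemLp (fun z : EuclideanSpace ℝ (Fin n) => z i) 2
      (multivariateGaussian 0 S) :=
    (EuclideanSpace.proj (𝕜 := ℝ) i).comp_memLp' hL2
  simp_rw [hsq]
  rw [← ofReal_integral_eq_lintegral_ofReal hint (by filter_upwards with z; positivity)]
  congr 1
  simp_rw [EuclideanSpace.real_norm_sq_eq]
  rw [integral_finsetSum _ fun i _ => (hcoord i).integrable_sq]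
  refine Finset.sum_congr rfl fun i _ => ?_
  rw [Matrix.diag_apply, ← variance_eval_multivariateGaussian (μ := 0) hS,
    variance_eq_sub (hcoord i)]
  have h0 : ∫ z, z i ∂(multivariateGaussian (0 : EuclideanSpace ℝ (Fin n)) S) = 0 := by
    have h := (EuclideanSpace.proj (𝕜 := ℝ) i).integral_comp_id_comm
      (hL2.integrable (by norm_num))
    simpa using h
  simp [h0]

/-- A Gaussian law with nonzero covariance has a coordinate with positive variance. -/
lemma nullSingletonClass_multivariateGaussian (μ : EuclideanSpace ℝ (Fin n)) (hS : S.PosSemidef)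
    (h0 : S ≠ 0) : NullSingletonClass (multivariateGaussian μ S) := by
  obtain ⟨i, hi⟩ : ∃ i, S i i ≠ 0 := by
    by_contra! hall
    exact h0 (hS.trace_eq_zero_iff.1 (Finset.sum_eq_zero fun i _ => hall i))
  have hi' : (S i i).toNNReal ≠ 0 := by
    rw [Ne, Real.toNNReal_eq_zero, not_le]
    exact hS.diag_nonneg.lt_of_ne' hi
  have := nullSingletonClass_gaussianReal (μ := μ i) hi'
  refine ⟨fun x => ?_⟩
  refine measure_mono_null (t := (fun y : EuclideanSpace ℝ (Fin n) => y i) ⁻¹' {x i})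
    (fun y hy => by rw [hy]; rfl) ?_
  rw [(measurePreserving_eval_multivariateGaussian hS).measure_preimage
    (measurableSet_singleton _).nullMeasurableSet, measure_singleton]

/-- Increasing the covariance of a Gaussian source from `S₁` to `S₂` costs little: reproduce the
larger source through the smaller one, which adds `tr (S₂ - S₁)` to the error, and remove the
excess by mixing with a channel of error `D / 2` and finite rate. -/
theorem rateDistortion_multivariateGaussian_le_add (μ : EuclideanSpace ℝ (Fin n))
    (h₁ : S₁.PosSemidef) (h : (S₂ - S₁).PosSemidef) {D ε : ℝ≥0} (hε : 0 < ε) (hε1 : ε < 1)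
    (htr : (S₂ - S₁).trace ≤ ε * (D / 2)) :
    rateDistortion (multivariateGaussian μ S₂) D ≤
      rateDistortion (multivariateGaussian μ S₁) D +
        ε * rateDistortion (multivariateGaussian μ S₂) (D / 2) := by
  have hconv := multivariateGaussian_conv μ 0 h₁ h
  rw [add_zero, add_sub_cancel] at hconv
  have hstep : rateDistortion (multivariateGaussian μ S₂) (D + ε * (D / 2)) ≤
      rateDistortion (multivariateGaussian μ S₁) D := by
    rw [← hconv]
    refine rateDistortion_conv_le _ _ IsGaussian.memLp_two_id (by simp) ?_ D
    rw [lintegral_enorm_sq_multivariateGaussian h]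
    exact ENNReal.ofReal_le_of_le_toReal (by simpa using htr)
  have h1ε : 1 - ε ≠ 0 := (tsub_pos_of_lt hε1).ne'
  have hmix := rateDistortion_convex (multivariateGaussian μ S₂) (D + ε * (D / 2)) (D / 2)
    (tsub_add_cancel_of_le hε1.le) h1ε hε.ne'
  have hD : (1 - ε) * (D + ε * (D / 2)) + ε * (D / 2) ≤ D := by
    rw [← NNReal.coe_le_coe]
    push_cast [NNReal.coe_sub hε1.le]
    have h2 : (0 : ℝ) ≤ ε ^ 2 * D := by positivity
    nlinarith
  refine (rateDistortion_anti _ hD).trans (hmix.trans ?_)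
  gcongr
  refine le_trans (mul_le_of_le_one_left (zero_le) ?_) hstep
  exact_mod_cast tsub_le_self

end Gaussian

section Limit

variable {n : ℕ} {A N V : Matrix (Fin n) (Fin n) ℝ}

theorem rateDistortion_incrementLaw_le (hVpos : V.PosSemidef) (hN : N.PosSemidef)
    (hV : A * V + V * Aᵀ + N = 0) (D h : ℝ≥0) (x μ : EuclideanSpace ℝ (Fin n)) :
    rateDistortion (incrementLaw A N h x) D ≤ rateDistortion (multivariateGaussian μ V) D :=
  rateDistortion_multivariateGaussian_mono _ _ (posSemidef_noiseGramian A hN h)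
    (posSemidef_sub_noiseGramian hVpos hV h) D

theorem rateDistortion_incrementLaw_mono (hN : N.PosSemidef) (hV : A * V + V * Aᵀ + N = 0)
    (D : ℝ≥0) {h₁ h₂ : ℝ≥0} (h : h₁ ≤ h₂) (x₁ x₂ : EuclideanSpace ℝ (Fin n)) :
    rateDistortion (incrementLaw A N h₁ x₁) D ≤ rateDistortion (incrementLaw A N h₂ x₂) D := by
  refine rateDistortion_multivariateGaussian_mono _ _ (posSemidef_noiseGramian A hN h₁) ?_ D
  rw [noiseGramian_sub hV h]
  exact posSemidef_exp_mul_mul_exp A (posSemidef_noiseGramian A hN _) _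

/-- No rate below the limit bounds the rates of all increments. -/
lemma IsHurwitz.rateDistortion_le_iSup (hA : IsHurwitz A) (hN : N.PosSemidef)
    (hV : A * V + V * Aᵀ + N = 0) (D : ℝ≥0) (x μ : EuclideanSpace ℝ (Fin n)) :
    rateDistortion (multivariateGaussian μ V) D ≤
      ⨆ h : ℝ≥0, rateDistortion (incrementLaw A N h x) D := by
  have hVpos := hA.posSemidef_lyapunov hN hV
  have hW (h : ℝ≥0) := posSemidef_noiseGramian A hN h
  have hlim := hA.tendsto_noiseGramian hV
  have hmean (h : ℝ≥0) : rateDistortion (multivariateGaussian μ (noiseGramian A N h)) D ≤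
      ⨆ h : ℝ≥0, rateDistortion (incrementLaw A N h x) D :=
    (rateDistortion_multivariateGaussian_mono μ (meanIncrement A h x) (hW h)
      (by rw [sub_self]; exact .zero) D).trans
      (le_iSup (fun h : ℝ≥0 => rateDistortion (incrementLaw A N h x) D) h)
  by_cases hV0 : V = 0
  · refine le_trans (le_of_eq ?_) (hmean 0)
    rw [noiseGramian_eq hV, hV0]; simp
  obtain rfl | hD := eq_zero_or_pos D
  · -- exact reproduction of an atomless source has infinite rate
    obtain ⟨h, hne⟩ := (hlim.eventually_ne hV0).exists
    have := nullSingletonClass_multivariateGaussian μ (hW h) hne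
    refine le_trans ?_ (hmean h)
    rw [rateDistortion_zero_eq_top (multivariateGaussian μ (noiseGramian A N h))]
    exact le_top
  · have hfin : rateDistortion (multivariateGaussian μ V) (D / 2) ≠ ∞ :=
      rateDistortion_ne_top IsGaussian.memLp_two_id (half_pos hD)
    have hbound {ε : ℝ≥0} (hε : 0 < ε) (hε1 : ε < 1) :
        rateDistortion (multivariateGaussian μ V) D ≤
          (⨆ h : ℝ≥0, rateDistortion (incrementLaw A N h x) D) +
            ε * rateDistortion (multivariateGaussian μ V) (D / 2) := by
      have htr : Tendsto (fun h : ℝ≥0 => (V - noiseGramian A N h).trace) atTop (𝓝 0) := by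
        have hc : Continuous fun M : Matrix (Fin n) (Fin n) ℝ => (V - M).trace := by fun_prop
        simpa [Function.comp_def] using (hc.tendsto V).comp hlim
      obtain ⟨h, hh⟩ := (htr.eventually_le_const (u := (ε * (D / 2) : ℝ)) (by positivity)).exists
      exact (rateDistortion_multivariateGaussian_le_add μ (hW h)
        (posSemidef_sub_noiseGramian hVpos hV h) hε hε1 hh).trans (by gcongr; exact hmean h)
    have hl : Tendsto (fun ε : ℝ≥0 => (⨆ h : ℝ≥0, rateDistortion (incrementLaw A N h x) D) +
        ε * rateDistortion (multivariateGaussian μ V) (D / 2)) (𝓝[>] 0)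
        (𝓝 (⨆ h : ℝ≥0, rateDistortion (incrementLaw A N h x) D)) := by
      have h1 : Tendsto (fun ε : ℝ≥0 => (ε : ℝ≥0∞) *
          rateDistortion (multivariateGaussian μ V) (D / 2)) (𝓝[>] 0) (𝓝 0) := by
        have h2 := ENNReal.Tendsto.mul_const
          (b := rateDistortion (multivariateGaussian μ V) (D / 2)) (ENNReal.tendsto_coe.2 (tendsto_nhdsWithin_of_tendsto_nhds tendsto_id :
            Tendsto id (𝓝[>] (0 : ℝ≥0)) (𝓝 0))) (Or.inr hfin)
        simpa using h2
      simpa using h1.const_add (⨆ h : ℝ≥0, rateDistortion (incrementLaw A N h x) D)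
    refine ge_of_tendsto hl ?_
    filter_upwards [Ioo_mem_nhdsGT one_pos] with ε hε
    exact hbound hε.1 hε.2

theorem IsHurwitz.tendsto_rateDistortion (hA : IsHurwitz A) (hN : N.PosSemidef)
    (hV : A * V + V * Aᵀ + N = 0) (D : ℝ≥0) (x μ : EuclideanSpace ℝ (Fin n)) :
    Tendsto (fun h : ℝ≥0 => rateDistortion (incrementLaw A N h x) D) atTop
      (𝓝 (rateDistortion (multivariateGaussian μ V) D)) := by
  have hVpos := hA.posSemidef_lyapunov hN hV
  have hsup : ⨆ h : ℝ≥0, rateDistortion (incrementLaw A N h x) D =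
      rateDistortion (multivariateGaussian μ V) D :=
    le_antisymm (iSup_le fun h => rateDistortion_incrementLaw_le hVpos hN hV D h x μ)
      (hA.rateDistortion_le_iSup hN hV D x μ)
  rw [← hsup]
  exact tendsto_atTop_iSup fun h₁ h₂ h => rateDistortion_incrementLaw_mono hN hV D h x x

end Limit

end LinSys

theorem proposition2 {n : ℕ} (A N : Matrix (Fin n) (Fin n) ℝ) (hA : LinSys.IsHurwitz A)
    (hN : N.PosSemidef) :
    -- the change of state is the Gaussian source with mean `(exp(hA) - I) X(t)` and covariance `W(h)`
    (∀ (Ω : Type*) [MeasurableSpace Ω] (P : Measure Ω) [IsProbabilityMeasure P]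
      (ℱ : Filtration ℝ≥0 ‹MeasurableSpace Ω›) (w X : ℝ≥0 → Ω → EuclideanSpace ℝ (Fin n)),
      LinSys.IsBrownianMotion N ℱ P w → LinSys.IsSolution A ℱ P w X →
      ∀ t h : ℝ≥0, ∀ᵐ x ∂(P.map (X t)),
        LinSys.changeOfState P X t h x = LinSys.incrementLaw A N h x) ∧
    -- the Lyapunov equation has a unique solution
    ∃ Winf : Matrix (Fin n) (Fin n) ℝ,
      (∀ V : Matrix (Fin n) (Fin n) ℝ, A * V + V * Aᵀ + N = 0 ↔ V = Winf) ∧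
      Winf.PosSemidef ∧ (N.PosDef → Winf.PosDef) ∧
      -- the upper bound
      (∀ (D h : ℝ≥0) (x μ : EuclideanSpace ℝ (Fin n)),
        LinSys.rateDistortion (LinSys.incrementLaw A N h x) D ≤
          LinSys.rateDistortion (multivariateGaussian μ Winf) D) ∧
      -- the rate does not depend on the state `x` and is non-decreasing in `h`
      (∀ (D h₁ h₂ : ℝ≥0) (x₁ x₂ : EuclideanSpace ℝ (Fin n)), h₁ ≤ h₂ →
        LinSys.rateDistortion (LinSys.incrementLaw A N h₁ x₁) D ≤
          LinSys.rateDistortion (LinSys.incrementLaw A N h₂ x₂) D) ∧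
      -- the limit
      (∀ (D : ℝ≥0) (x μ : EuclideanSpace ℝ (Fin n)),
        Tendsto (fun h : ℝ≥0 => LinSys.rateDistortion (LinSys.incrementLaw A N h x) D) atTop
          (𝓝 (LinSys.rateDistortion (multivariateGaussian μ Winf) D))) := by
  refine ⟨fun Ω _ P _ ℱ w X hw hX t h => hX.changeOfState_ae_eq hw hN t h, ?_⟩
  obtain ⟨V, hV⟩ := hA.exists_lyapunov N
  have hVeq := (hV V).2 rfl
  have hVpos := hA.posSemidef_lyapunov hN hVeq
  exact ⟨V, hV, hVpos, fun hN' => LinSys.posDef_lyapunov hN' hVpos hVeq,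
    fun D h x μ => LinSys.rateDistortion_incrementLaw_le hVpos hN hVeq D h x μ,
    fun D _ _ x₁ x₂ h => LinSys.rateDistortion_incrementLaw_mono hN hVeq D h x₁ x₂,
    fun D x μ => hA.tendsto_rateDistortion hN hVeq D x μ⟩
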